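/- Let $(\mathcal M,\tau)$ be a tracial $W^*$-probability space, i.e. $\mathcal M$ is a von Neumann algebra (acting on a complex Hilbert space) and $\tau$ is a faithful normal tracial state on $\mathcal M$; let $\mathcal M^{sa}$ be its set of selfadjoint elements and let $N\ge 1$. Notation. Let $M_n^{sa}$ be the space of selfadjoint complex $n\times n$ matrices, $\mathrm{tr}_n$ the normalized trace, $\|\cdot\|$ the operator norm, $d\Lambda_n(A)=2^{n(n-1)/2}\prod_i dA_{ii}\prod_{i<j}d(\mathrm{Re}\,A_{ij})\,d(\mathrm{Im}\,A_{ij})$, and $(M_n^{sa})_R=\{A\in M_n^{sa}:\|A\|\le R\}$. Let $\mathbb C\langle X_1,\dots,X_N\rangle$ be the algebra of noncommutative polynomials with the involution given by $X_i^*=X_i$, and let $\mathbb C\langle X_1,\dots,X_N\rangle^{sa}$ be the set of its elements with $p=p^*$. For $R>0$ and $p\in\mathbb C\langle X_1,\dots,X_N\rangle^{sa}$ put $$\pi_R(p):=\limsup_{n\to\infty}\Bigl(\frac1{n^2}\log\int_{(M_n^{sa})_R^N}\exp\bigl(-n^2\,\mathrm{tr}_n(p(A_1,\dots,A_N))\bigr)\,d\Lambda_n^{\otimes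 N}(A_1,\dots,A_N)+\frac N2\log n\Bigr),$$ and for $a_1,\dots,a_N\in\mathcal M^{sa}$ put $$\eta_R(a_1,\dots,a_N):=\inf\bigl\{\tau(p(a_1,\dots,a_N))+\pi_R(p):p\in\mathbb C\langle X_1,\dots,X_N\rangle^{sa}\bigr\},\qquad \eta(a_1,\dots,a_N):=\sup_{R>0}\eta_R(a_1,\dots,a_N),$$ with values in $[-\infty,+\infty]$. Proposition 4.8. Let $a_1,\dots,a_N,b_1,\dots,b_N\in\mathcal M^{sa}$ be such that $b_1=a_1$ and $b_i-a_i\in\{a_1,\dots,a_{i-1}\}''$ (the double commutant) for $2\le i\le N$, and let $R_0:=\max_{1\le i\le N}\|b_i-a_i\|$. Then, for every $R>0$, $$\eta_R(a_1,\dots,a_N)\le\eta_{R+R_0}(b_1,\dots,b_N)\quad\text{if }R\ge\max_i\|a_i\|,$$ $$\eta_R(b_1,\dots,b_N)\le\eta_{R+R_0}(a_1,\dots,a_N)\quad\text{if }R\ge\max_i\|b_i\|.$$ Moreover, $\eta(a_1,\dots,a_N)=\eta(b_1,\dots,b_N)$. -/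

import Mathlib

open MeasureTheory Filter

noncomputable section

/-! ### Noncommutative polynomials -/

/-- The algebra `ℂ⟨X_1, …, X_N⟩` of polynomials in `N` noncommuting indeterminates. -/
abbrev NCPoly (N : ℕ) : Type := MonoidAlgebra ℂ (FreeMonoid (Fin N))

/-- `p = p*` for the conjugate-linear, product-reversing involution of `ℂ⟨X_1, …, X_N⟩` with
`X_i* = X_i`: the coefficient of each reversed word is the conjugate of that of the word. -/
def NCPoly.IsSA {N : ℕ} (p : NCPoly N) : Prop :=
  ∀ w : FreeMonoid (Fin N), p.coeff w.reverse = starRingEnd ℂ (p.coeff w)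

/-- The evaluation `p ↦ p(x_1, …, x_N)` in a complex unital algebra. -/
def NCPoly.evalHom {N : ℕ} {A : Type*} [Ring A] [Algebra ℂ A] (x : Fin N → A) :
    NCPoly N →ₐ[ℂ] A :=
  MonoidAlgebra.lift ℂ A (FreeMonoid (Fin N)) (FreeMonoid.lift x)

/-! ### Selfadjoint matrices and their Lebesgue measure -/

/-- The real vector space `M_n^{sa}` of selfadjoint complex `n × n` matrices. -/
abbrev MatSA (n : ℕ) : Type := selfAdjoint (Matrix (Fin n) (Fin n) ℂ)

instance MatSA.measurableSpace (n : ℕ) : MeasurableSpace (MatSA n) := borel (MatSA n)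

instance MatSA.borelSpace (n : ℕ) : BorelSpace (MatSA n) := ⟨rfl⟩

/-- The selfadjoint matrix with real coordinates `x`: the diagonal entries are `x i i`, and for
`i < j` the real and imaginary parts of the `(i, j)` entry are `x i j` and `x j i`. -/
def MatSA.ofCoords (n : ℕ) (x : Fin n → Fin n → ℝ) : MatSA n :=
  ⟨Matrix.of fun i j =>
      if i = j then (x i i : ℂ)
      else if i < j then (x i j : ℂ) + (x j i : ℂ) * Complex.I
      else (x j i : ℂ) - (x i j : ℂ) * Complex.I, by
    rw [selfAdjoint.mem_iff, Matrix.star_eq_conjTranspose]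
    ext i j
    rcases lt_trichotomy i j with h | h | h
    · simp [Matrix.conjTranspose_apply, h, h.ne, h.ne', h.not_gt, sub_eq_add_neg]
    · subst h
      simp [Matrix.conjTranspose_apply]
    · simp [Matrix.conjTranspose_apply, h, h.ne, h.ne', h.not_gt, sub_eq_add_neg]⟩

/-- The measure `dΛ_n(A) = 2^{n(n-1)/2} ∏_i dA_ii ∏_{i<j} d(Re A_ij) d(Im A_ij)`. -/
def lebSA (n : ℕ) : Measure (MatSA n) :=
  (2 : ENNReal) ^ (n * (n - 1) / 2) • Measure.map (MatSA.ofCoords n) volume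

/-- The operator norm of a matrix acting on the Hilbert space `ℂ^n`. -/
def matOpNorm {n : ℕ} (A : Matrix (Fin n) (Fin n) ℂ) : ℝ :=
  ‖Matrix.toEuclideanCLM (n := Fin n) (𝕜 := ℂ) A‖

/-- The normalized trace `tr_n`. -/
def normTrace {n : ℕ} (A : Matrix (Fin n) (Fin n) ℂ) : ℂ := A.trace / n

/-- The set `(M_n^{sa})_R^N` of `N`-tuples of selfadjoint matrices of operator norm at most `R`. -/
def matBall (N n : ℕ) (R : ℝ) : Set (Fin N → MatSA n) :=
  {A | ∀ i, matOpNorm (A i : Matrix (Fin n) (Fin n) ℂ) ≤ R}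

/-! ### Free pressure and its Legendre transform -/

/-- `∫_{(M_n^{sa})_R^N} exp(-n² tr_n(p(A_1, …, A_N))) dΛ_n^{⊗N}(A_1, …, A_N)`; for selfadjoint `p`
the trace is real. For `R > 0` and `n ≥ 1` the integrand is continuous and positive, and the domain
is compact with nonempty interior, so that this is a positive real number. -/
def partitionFn {N : ℕ} (R : ℝ) (p : NCPoly N) (n : ℕ) : ℝ :=
  ∫ A in matBall N n R,
    Real.exp (-(n : ℝ) ^ 2 *
      (normTrace (NCPoly.evalHom (fun i => (A i : Matrix (Fin n) (Fin n) ℂ)) p)).re)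
    ∂(Measure.pi fun _ : Fin N => lebSA n)

/-- The free pressure `π_R(p)` of a selfadjoint noncommutative polynomial `p`. -/
def freePressure {N : ℕ} (R : ℝ) (p : NCPoly N) : EReal :=
  limsup (fun n : ℕ =>
    ((1 / (n : ℝ) ^ 2 * Real.log (partitionFn R p n) + (N : ℝ) / 2 * Real.log n : ℝ) : EReal)) atTop

/-- `η_R(μ) = inf {μ(p) + π_R(p) : p = p*}` for a linear functional `μ` on `ℂ⟨X_1, …, X_N⟩` that is
real on selfadjoint polynomials. -/
def etaFunctional {N : ℕ} (R : ℝ) (μ : NCPoly N →ₗ[ℂ] ℂ) : EReal :=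
  ⨅ p : {p : NCPoly N // p.IsSA}, (((μ p.1).re : ℝ) : EReal) + freePressure R p.1

/-! ### Tracial `W*`-probability spaces -/

section Tracial

variable {H : Type*} [NormedAddCommGroup H] [InnerProductSpace ℂ H] [CompleteSpace H]

open scoped ComplexOrder in
/-- A faithful normal tracial state on a von Neumann algebra `M` acting on `H`. Normality is
`σ`-weak continuity, i.e. the functional belongs to the predual of `M`: it is of the form
`x ↦ ∑ k, ⟪ξ_k, x ζ_k⟫` with `∑ k, ‖ξ_k‖² < ∞` and `∑ k, ‖ζ_k‖² < ∞`. -/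
structure FaithfulNormalTrace (M : VonNeumannAlgebra H) where
  toLinearMap : M.toStarSubalgebra →ₗ[ℂ] ℂ
  map_one : toLinearMap 1 = 1
  nonneg : ∀ x, 0 ≤ toLinearMap (star x * x)
  tracial : ∀ x y, toLinearMap (x * y) = toLinearMap (y * x)
  faithful : ∀ x, toLinearMap (star x * x) = 0 → x = 0
  normal : ∃ ξ ζ : ℕ → H, Summable (fun k => ‖ξ k‖ ^ 2) ∧ Summable (fun k => ‖ζ k‖ ^ 2) ∧
    ∀ x : M.toStarSubalgebra,
      HasSum (fun k => inner ℂ (ξ k) ((x : H →L[ℂ] H) (ζ k))) (toLinearMap x)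

variable {M : VonNeumannAlgebra H} (τ : FaithfulNormalTrace M) {N : ℕ}

/-- The joint distribution `μ_{(a_1, …, a_N)}(p) = τ(p(a_1, …, a_N))`. -/
def ncLaw (a : Fin N → M.toStarSubalgebra) : NCPoly N →ₗ[ℂ] ℂ :=
  τ.toLinearMap ∘ₗ (NCPoly.evalHom a).toLinearMap

/-- `η_R(a_1, …, a_N)`. -/
def etaR (R : ℝ) (a : Fin N → M.toStarSubalgebra) : EReal := etaFunctional R (ncLaw τ a)

/-- `η(a_1, …, a_N) = sup_{R > 0} η_R(a_1, …, a_N)`. -/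
def eta (a : Fin N → M.toStarSubalgebra) : EReal := ⨆ R : {R : ℝ // 0 < R}, etaR τ R.1 a

end Tracial

end

/-! Write `c i = b i - a i`. If `c i` were a polynomial `p i` in the `a j` with `j < i`, then the
map `A i ↦ A i + p i (A)` would be a triangular shear of matrix tuples. It preserves Lebesgue
measure, and when `‖p i (A)‖ ≤ C` on the ball of radius `R` it carries that ball into the one of
radius `R + C`. Hence the pressure of the sheared polynomial `q(X + p)` at `R` is at most that of
`q` at `R + C` (`partitionFn_shear_le`), and minimizing over `q` gives `η_R(a) ≤ η_{R+C}(b)`.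

In general `c i` is only a 2-norm limit of values `p i (a)`. The approximants must keep the same
bound `C` on matrices of every size, or the radius `R + C` is lost. A Kaplansky argument with
explicit polynomials does this (`IsTracialState.exists_uniformlyBounded_near`): `c = 2C f(d)` with
`f(t) = t / (1 + t²)`, where `d` is approximated by polynomials without norm control and `f` is
2-norm Lipschitz; replacing `2C f` by a real polynomial `h` bounded by `C` on a large interval
yields `p = h(s)`. The 2-norm density used for `d` is von Neumann's theorem on an amplification.
Bounded 2-norm convergence then gives `τ(q(a + p(a))) → τ(q(b))`.

The reverse inequality is the same statement with `a` and `b` exchanged, since `{a j : j < i}'' ⊆ {b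
j : j < i}''`. -/

noncomputable section

/-! ### Involution, evaluation and norm bounds for noncommutative polynomials. -/

namespace NCPoly

variable {N : ℕ}

instance : Star (NCPoly N) where
  star p := MonoidAlgebra.mapDomain star (MonoidAlgebra.map (starRingEnd ℂ).toAddMonoidHom p)

theorem star_def (p : NCPoly N) : star p =
    MonoidAlgebra.mapDomain star (MonoidAlgebra.map (starRingEnd ℂ).toAddMonoidHom p) := rfl

theorem star_single (w : FreeMonoid (Fin N)) (c : ℂ) :
    star (MonoidAlgebra.single w c : NCPoly N) =
      MonoidAlgebra.single (star w) (starRingEnd ℂ c) := by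
  simp [star_def]

theorem star_add' (p q : NCPoly N) : star (p + q) = star p + star q := by
  rw [star_def, MonoidAlgebra.map_add, MonoidAlgebra.mapDomain_add]
  rfl

theorem coeff_star (p : NCPoly N) (w : FreeMonoid (Fin N)) :
    (star p).coeff w = starRingEnd ℂ (p.coeff w.reverse) := by
  induction p using MonoidAlgebra.induction_linear with
  | zero => simp [star_def]
  | add p q hp hq => simp [star_add', hp, hq]
  | single v c =>
    have h : star v = w ↔ v = w.reverse := by
      rw [star_eq_iff_star_eq, eq_comm]; rfl
    rw [star_single, MonoidAlgebra.coeff_single, MonoidAlgebra.coeff_single]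
    classical
    rw [Finsupp.single_apply, Finsupp.single_apply, if_congr h rfl rfl, apply_ite (starRingEnd ℂ),
      map_zero]

instance : StarRing (NCPoly N) where
  star_involutive p := by
    induction p using MonoidAlgebra.induction_linear with
    | zero => simp [star_def]
    | add p q hp hq => simp [star_add', hp, hq]
    | single v c => simp [star_single]
  star_add := star_add'
  star_mul p q := by
    induction p using MonoidAlgebra.induction_linear with
    | zero => simp [star_def]
    | add p p' hp hp' => simp [star_add', add_mul, mul_add, hp, hp']
    | single v c =>
      induction q using MonoidAlgebra.induction_linear with
      | zero => simp [star_def]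
      | add q q' hq hq' => simp [star_add', add_mul, mul_add, hq, hq']
      | single w d => simp [star_single, MonoidAlgebra.single_mul_single, mul_comm]

instance : StarModule ℂ (NCPoly N) where
  star_smul c p := by
    induction p using MonoidAlgebra.induction_linear with
    | zero => simp
    | add p q hp hq => simp [hp, hq]
    | single w d => simp [star_single]

theorem isSA_iff (p : NCPoly N) : p.IsSA ↔ IsSelfAdjoint p := by
  rw [isSelfAdjoint_iff, IsSA]
  constructor
  · intro h
    ext w
    rw [coeff_star, h, starRingEnd_self_apply]
  · intro h w
    have := coeff_star p w
    rw [h] at this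
    rw [this, starRingEnd_self_apply]

/-- The indeterminate `X_i`. -/
def X (i : Fin N) : NCPoly N := MonoidAlgebra.single (FreeMonoid.of i) 1

theorem isSelfAdjoint_X (i : Fin N) : IsSelfAdjoint (X i : NCPoly N) := by
  rw [isSelfAdjoint_iff, X, star_single]
  simp

section Eval

variable {A : Type*} [Ring A] [Algebra ℂ A]

@[simp]
theorem evalHom_X (x : Fin N → A) (i : Fin N) : evalHom x (X i) = x i := by
  simp [evalHom, X]

theorem evalHom_single (x : Fin N → A) (w : FreeMonoid (Fin N)) (c : ℂ) :
    evalHom x (MonoidAlgebra.single w c) = c • FreeMonoid.lift x w := by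
  simp [evalHom]

theorem map_evalHom {B : Type*} [Ring B] [Algebra ℂ B] (φ : A →ₐ[ℂ] B) (x : Fin N → A)
    (p : NCPoly N) : φ (evalHom x p) = evalHom (fun i => φ (x i)) p := by
  induction p using MonoidAlgebra.induction_linear with
  | zero => simp
  | add p q hp hq => simp [hp, hq]
  | single w c =>
    simp only [evalHom_single, map_smul]
    congr 1
    induction w using FreeMonoid.inductionOn' with
    | one => simp
    | of_mul i w ih => simp [ih]

theorem evalHom_evalHom (y : Fin N → A) (x : Fin N → NCPoly N) (p : NCPoly N) :
    evalHom y (evalHom x p) = evalHom (fun i => evalHom y (x i)) p :=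
  map_evalHom (evalHom y) x p

theorem evalHom_X_self (p : NCPoly N) : evalHom X p = p := by
  induction p using MonoidAlgebra.induction_linear with
  | zero => simp
  | add p q hp hq => simp [hp, hq]
  | single w c =>
    have : FreeMonoid.lift X w = (MonoidAlgebra.single w 1 : NCPoly N) := by
      induction w using FreeMonoid.inductionOn' with
      | one => simp [MonoidAlgebra.one_def]
      | of_mul i w ih => simp [ih, X, MonoidAlgebra.single_mul_single]
    rw [evalHom_single, this]
    simp

theorem star_evalHom [StarRing A] [StarModule ℂ A] {x : Fin N → A}
    (hx : ∀ i, IsSelfAdjoint (x i)) (p : NCPoly N) :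
    star (evalHom x p) = evalHom x (star p) := by
  induction p using MonoidAlgebra.induction_linear with
  | zero => simp
  | add p q hp hq => simp [hp, hq]
  | single w c =>
    rw [star_single, evalHom_single, evalHom_single, star_smul, ← starRingEnd_apply]
    congr 1
    induction w using FreeMonoid.inductionOn' with
    | one => simp
    | of_mul i w ih => simp [ih, (hx i).star_eq]

theorem isSelfAdjoint_evalHom [StarRing A] [StarModule ℂ A] {x : Fin N → A}
    (hx : ∀ i, IsSelfAdjoint (x i)) {p : NCPoly N} (hp : IsSelfAdjoint p) :
    IsSelfAdjoint (evalHom x p) := by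
  rw [isSelfAdjoint_iff, star_evalHom hx, hp.star_eq]

end Eval

/-- The subalgebra generated by the indeterminates `X_j` with `j < i`. -/
def below (i : Fin N) : Subalgebra ℂ (NCPoly N) := Algebra.adjoin ℂ (X '' Set.Iio i)

/-- This is what makes the shear by a family with `p i ∈ below i` triangular. -/
theorem evalHom_congr_of_mem_below {A : Type*} [Ring A] [Algebra ℂ A] {i : Fin N} {p : NCPoly N}
    (hp : p ∈ below i) {x y : Fin N → A} (h : ∀ j < i, x j = y j) :
    evalHom x p = evalHom y p := by
  have : below i ≤ AlgHom.equalizer (evalHom x) (evalHom y) := by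
    refine Algebra.adjoin_le ?_
    rintro _ ⟨j, hj, rfl⟩
    simpa using h j hj
  exact this hp

theorem star_mem_below {i : Fin N} {p : NCPoly N} (hp : p ∈ below i) : star p ∈ below i := by
  induction hp using Algebra.adjoin_induction with
  | mem x hx =>
    obtain ⟨j, hj, rfl⟩ := hx
    rw [(isSelfAdjoint_X j).star_eq]
    exact Algebra.subset_adjoin ⟨j, hj, rfl⟩
  | algebraMap r =>
    rw [← algebraMap_star_comm]
    exact Subalgebra.algebraMap_mem _ _
  | add x y _ _ hx hy => rw [star_add]; exact add_mem hx hy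
  | mul x y _ _ hx hy => rw [star_mul]; exact mul_mem hy hx

/-- A bound for the norm of `p(x_1, …, x_N)` when `‖x_i‖ ≤ R`. -/
def coeffBound (R : ℝ) (p : NCPoly N) : ℝ :=
  p.coeff.sum fun w c => ‖c‖ * R ^ w.length

/-- Assuming only `‖1‖ ≤ 1` admits the zero algebra, such as the operators on `ℂ^0`. -/
theorem norm_lift_le {A : Type*} [NormedRing A] (h1 : ‖(1 : A)‖ ≤ 1) {R : ℝ}
    {x : Fin N → A} (hx : ∀ i, ‖x i‖ ≤ R) (w : FreeMonoid (Fin N)) :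
    ‖FreeMonoid.lift x w‖ ≤ R ^ w.length := by
  induction w using FreeMonoid.inductionOn' with
  | one => simpa using h1
  | of_mul i w ih =>
    have hR : 0 ≤ R := (norm_nonneg _).trans (hx i)
    rw [map_mul, FreeMonoid.lift_eval_of, FreeMonoid.length_mul, FreeMonoid.length_of, pow_add,
      pow_one]
    exact (norm_mul_le _ _).trans (mul_le_mul (hx i) ih (norm_nonneg _) hR)

theorem norm_evalHom_le {A : Type*} [NormedRing A] [NormedAlgebra ℂ A] (h1 : ‖(1 : A)‖ ≤ 1)
    {R : ℝ} {x : Fin N → A} (hx : ∀ i, ‖x i‖ ≤ R) (p : NCPoly N) :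
    ‖evalHom x p‖ ≤ coeffBound R p := by
  rw [evalHom, MonoidAlgebra.lift_apply, coeffBound, Finsupp.sum, Finsupp.sum]
  refine (norm_sum_le _ _).trans (Finset.sum_le_sum fun w _ => ?_)
  rw [norm_smul]
  exact mul_le_mul_of_nonneg_left (norm_lift_le h1 hx w) (norm_nonneg _)

end NCPoly

/-! ### Functional calculus of `t / (1 + t²)` and its polynomial approximation. -/

section CStar

open Polynomial

/-- The value of a polynomial with real coefficients at an element of a complex algebra. -/
def realAeval {A : Type*} [Ring A] [Algebra ℂ A] (x : A) (h : ℝ[X]) : A :=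
  aeval x (h.map (algebraMap ℝ ℂ))

theorem map_realAeval {A B : Type*} [Ring A] [Algebra ℂ A] [Ring B] [Algebra ℂ B] (φ : A →ₐ[ℂ] B)
    (x : A) (h : ℝ[X]) : φ (realAeval x h) = realAeval (φ x) h := by
  simp only [realAeval, aeval_algHom_apply]

theorem IsSelfAdjoint.realAeval {A : Type*} [Ring A] [Algebra ℂ A] [StarRing A] [StarModule ℂ A]
    {x : A} (hx : IsSelfAdjoint x) (h : ℝ[X]) : IsSelfAdjoint (realAeval x h) := by
  induction h using Polynomial.induction_on' with
  | add p q hp hq =>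
    simp only [_root_.realAeval, Polynomial.map_add, map_add] at hp hq ⊢
    exact hp.add hq
  | monomial n a =>
    simp only [_root_.realAeval, Polynomial.map_monomial, aeval_monomial, ← Algebra.smul_def]
    exact IsSelfAdjoint.smul (by simp [isSelfAdjoint_iff]) (hx.pow n)

theorem realAeval_mem {A : Type*} [Ring A] [Algebra ℂ A] {S : Subalgebra ℂ A} {x : A} (hx : x ∈ S)
    (h : ℝ[X]) : realAeval x h ∈ S :=
  Algebra.adjoin_le (Set.singleton_subset_iff.2 hx) (aeval_mem_adjoin_singleton ℂ x)

variable {A : Type*} [CStarAlgebra A]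

theorem realAeval_eq_cfc {x : A} (hx : IsSelfAdjoint x) (h : ℝ[X]) :
    realAeval x h = cfc h.eval x := by
  rw [realAeval, aeval_map_algebraMap, cfc_polynomial h x hx]

theorem abs_le_norm_of_mem_spectrum {x : A} {t : ℝ} (ht : t ∈ spectrum ℝ x) : |t| ≤ ‖x‖ := by
  have : ‖t‖ ≤ ‖x‖ * ‖(1 : A)‖ := spectrum.norm_le_norm_mul_of_mem ht
  refine this.trans ?_
  nontriviality A
  simp

theorem norm_cfc_le_of_forall_abs_le {x : A} (f : ℝ → ℝ) {L C : ℝ} (hx : ‖x‖ ≤ L)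
    (hC : 0 ≤ C) (h : ∀ t ∈ Set.Icc (-L) L, |f t| ≤ C) : ‖cfc f x‖ ≤ C :=
  norm_cfc_le hC fun t ht =>
    h t (abs_le.1 ((abs_le_norm_of_mem_spectrum ht).trans hx))

/-- The functional calculus of `t ↦ t / (1 + t²)`. -/
def cfcDivOneAddSq (x : A) : A := cfc (fun t : ℝ => t / (1 + t ^ 2)) x

theorem one_add_sq_ne_zero (t : ℝ) : 1 + t ^ 2 ≠ 0 := by positivity

theorem abs_div_one_add_sq_le (t : ℝ) : |t / (1 + t ^ 2)| ≤ 1 / 2 := by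
  rw [abs_div, abs_of_pos (by positivity : 0 < 1 + t ^ 2), div_le_iff₀ (by positivity)]
  nlinarith [sq_nonneg (|t| - 1), sq_abs t]

theorem norm_cfcDivOneAddSq_le (x : A) : ‖cfcDivOneAddSq x‖ ≤ 1 / 2 :=
  norm_cfc_le (by norm_num) fun t _ => abs_div_one_add_sq_le t

/-- With `r = (1 + t²)⁻¹` and `f = t r`, the identity is `r(x) [x(1 + y²) - (1 + x²)y] r(y)`
expanded. The difference `x - y` occurs only between contractions, so `f` is Lipschitz for the
2-norm with a constant independent of `‖x‖` and `‖y‖`. -/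
theorem exists_cfcDivOneAddSq_sub (x y : A) (hx : IsSelfAdjoint x) (hy : IsSelfAdjoint y) :
    ∃ u v : A, ‖u‖ ≤ 1 ∧ ‖v‖ ≤ 1 ∧ cfcDivOneAddSq x - cfcDivOneAddSq y =
      u * (x - y) * v - cfcDivOneAddSq x * (x - y) * cfcDivOneAddSq y := by
  set r : A → A := fun x => cfc (fun t : ℝ => (1 + t ^ 2)⁻¹) x with hr
  have hcont : Continuous fun t : ℝ => (1 + t ^ 2)⁻¹ := by
    fun_prop (disch := intro t; positivity)
  have hnorm : ∀ x : A, ‖r x‖ ≤ 1 := fun x => norm_cfc_le zero_le_one fun t _ => by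
    rw [Real.norm_eq_abs, abs_of_pos (by positivity)]
    exact inv_le_one_of_one_le₀ (by nlinarith [sq_nonneg t])
  have hcomm : ∀ x : A, IsSelfAdjoint x → Commute (r x) x := fun x hx => by
    have := cfc_commute_cfc (fun t : ℝ => (1 + t ^ 2)⁻¹) id x
    rwa [cfc_id ℝ x] at this
  have hcs : ∀ x : A, IsSelfAdjoint x → cfcDivOneAddSq x = r x * x := fun x hx => by
    have h1 := cfc_mul (fun t : ℝ => (1 + t ^ 2)⁻¹) id x hcont.continuousOn continuousOn_id
    rw [cfc_id ℝ x] at h1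
    rw [← h1, cfcDivOneAddSq]
    congr 1
    ext t
    rw [div_eq_mul_inv, mul_comm, id]
  have hcs' : ∀ x : A, IsSelfAdjoint x → cfcDivOneAddSq x = x * r x := fun x hx => by
    rw [hcs x hx, (hcomm x hx).eq]
  have hinv : ∀ x : A, IsSelfAdjoint x → r x * (1 + x * x) = 1 := fun x hx => by
    have h1 : (1 + x * x : A) = cfc (fun t : ℝ => 1 + t ^ 2) x := by
      rw [cfc_const_add (1 : ℝ) (fun t => t ^ 2) x (by fun_prop), cfc_pow_id (R := ℝ) x 2, map_one,
        sq]
    rw [h1, hr, ← cfc_mul _ _ x hcont.continuousOn (by fun_prop), ← cfc_one ℝ x]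
    congr 1
    ext t
    exact inv_mul_cancel₀ (one_add_sq_ne_zero t)
  have hinv' : ∀ x : A, IsSelfAdjoint x → (1 + x * x) * r x = 1 := fun x hx => by
    have := (Commute.one_right (r x)).add_right ((hcomm x hx).mul_right (hcomm x hx))
    rw [← this.eq, hinv x hx]
  refine ⟨r x, r y, hnorm x, hnorm y, ?_⟩
  have key : cfcDivOneAddSq x - cfcDivOneAddSq y
      = r x * x * ((1 + y * y) * r y) - r x * (1 + x * x) * (y * r y) := by
    rw [hinv x hx, hinv' y hy, mul_one, one_mul, ← hcs x hx, ← hcs' y hy]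
  rw [key, hcs x hx, hcs' y hy]
  noncomm_ring

/-- The map `t ↦ 2t / (1 + t²)` is a bijection of `[-1, 1]` with inverse `s ↦ s / (1 + √(1 - s²))`.
-/
theorem exists_cfcDivOneAddSq_eq (c : A) (hc : IsSelfAdjoint c) (h1 : ‖c‖ ≤ 1) :
    ∃ g : ℝ → ℝ, ContinuousOn g (spectrum ℝ c) ∧ (2 : ℝ) • cfcDivOneAddSq (cfc g c) = c := by
  refine ⟨fun s => s / (1 + √(1 - s ^ 2)), ?_, ?_⟩
  · refine Continuous.continuousOn ?_
    fun_prop (disch := intro t; positivity)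
  · have hg : Continuous fun s : ℝ => s / (1 + √(1 - s ^ 2)) := by
      fun_prop (disch := intro t; positivity)
    have hS : Continuous fun t : ℝ => t / (1 + t ^ 2) := by
      fun_prop (disch := intro t; positivity)
    rw [cfcDivOneAddSq, ← cfc_comp' _ _ c hS.continuousOn hg.continuousOn,
      ← cfc_smul _ _ c (by exact (hS.comp hg).continuousOn)]
    conv_rhs => rw [← cfc_id' ℝ c]
    refine cfc_congr fun s hs => ?_
    have hs1 : s ^ 2 ≤ 1 := by
      rw [sq_le_one_iff_abs_le_one]
      exact (abs_le_norm_of_mem_spectrum hs).trans h1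
    have hu := Real.sq_sqrt (sub_nonneg.2 hs1)
    have hu0 := Real.sqrt_nonneg (1 - s ^ 2)
    set u := √(1 - s ^ 2)
    have : s ^ 2 = (1 - u) * (1 + u) := by linarith
    have h2 : 1 + (s / (1 + u)) ^ 2 = 2 / (1 + u) := by
      rw [div_pow, this]
      field_simp
      ring
    simp only [smul_eq_mul, h2]
    field_simp

theorem exists_polynomial_near_cfcDivOneAddSq (L : ℝ) {C δ : ℝ} (hC : 0 < C) (hδ : 0 < δ) :
    ∃ h : ℝ[X], (∀ t ∈ Set.Icc (-L) L, |h.eval t| ≤ C) ∧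
      ∀ t ∈ Set.Icc (-L) L, |h.eval t - C * (2 * (t / (1 + t ^ 2)))| ≤ δ := by
  -- Approximating the shrunk function `(C - η) · 2f` within `η` keeps `|h| ≤ C` exactly; the total
  -- error is at most `2η ≤ δ`.
  set η := min (δ / 2) C with hη
  have hη0 : 0 < η := lt_min (by linarith) hC
  have hηδ : η ≤ δ / 2 := min_le_left _ _
  have hηC : η ≤ C := min_le_right _ _
  have hS : Continuous fun t : ℝ => (C - η) * (2 * (t / (1 + t ^ 2))) := by
    fun_prop (disch := intro t; positivity)
  obtain ⟨h, hh⟩ := exists_polynomial_near_of_continuousOn (-L) L _ hS.continuousOn η hη0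
  refine ⟨h, fun t ht => ?_, fun t ht => ?_⟩
  · have h1 := abs_lt.1 (hh t ht)
    have h2 := abs_le.1 (abs_div_one_add_sq_le t)
    rw [abs_le]
    constructor <;> nlinarith
  · have h1 := abs_lt.1 (hh t ht)
    have h2 := abs_le.1 (abs_div_one_add_sq_le t)
    rw [abs_le]
    constructor <;> nlinarith

theorem norm_realAeval_le {x : A} (hx : IsSelfAdjoint x) {L C : ℝ} (hL : ‖x‖ ≤ L) (hC : 0 ≤ C)
    {h : ℝ[X]} (hh : ∀ t ∈ Set.Icc (-L) L, |h.eval t| ≤ C) : ‖realAeval x h‖ ≤ C := by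
  rw [realAeval_eq_cfc hx]
  exact norm_cfc_le_of_forall_abs_le _ hL hC hh

theorem norm_realAeval_sub_cfcDivOneAddSq_le {x : A} (hx : IsSelfAdjoint x) {L C δ : ℝ}
    (hL : ‖x‖ ≤ L) (hδ : 0 ≤ δ) {h : ℝ[X]}
    (hh : ∀ t ∈ Set.Icc (-L) L, |h.eval t - C * (2 * (t / (1 + t ^ 2)))| ≤ δ) :
    ‖realAeval x h - C • (2 : ℝ) • cfcDivOneAddSq x‖ ≤ δ := by
  have hS : Continuous fun t : ℝ => t / (1 + t ^ 2) := by
    fun_prop (disch := intro t; positivity)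
  rw [realAeval_eq_cfc hx, cfcDivOneAddSq, ← cfc_smul _ _ x hS.continuousOn,
    ← cfc_smul _ _ x (by exact (hS.const_smul (2 : ℝ)).continuousOn),
    ← cfc_sub _ _ x h.continuous.continuousOn
      (by exact ((hS.const_smul (2 : ℝ)).const_smul C).continuousOn)]
  exact norm_cfc_le_of_forall_abs_le _ hL hδ hh

end CStar

/-! ### Von Neumann's density theorem on a Hilbert sum of copies of `H`. -/

section Density

variable {H : Type*} [NormedAddCommGroup H] {ι : Type*}

theorem memℓp_two_iff {v : ι → H} :
    Memℓp (E := fun _ => H) v 2 ↔ Summable fun k => ‖v k‖ ^ 2 := by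
  rw [memℓp_gen_iff (by norm_num)]
  norm_num

theorem hasSum_norm_sq (v : lp (fun _ : ι => H) 2) :
    HasSum (fun k => ‖v k‖ ^ 2) (‖v‖ ^ 2) := by
  have := lp.hasSum_norm (p := 2) (by norm_num) v
  norm_num at this
  exact this

variable [InnerProductSpace ℂ H]

theorem norm_map_sq_le (T : H →L[ℂ] H) (h : H) : ‖T h‖ ^ 2 ≤ ‖T‖ ^ 2 * ‖h‖ ^ 2 := by
  rw [← mul_pow]
  exact pow_le_pow_left₀ (norm_nonneg _) (T.le_opNorm h) 2

theorem amplification_memℓp (T : H →L[ℂ] H) (v : lp (fun _ : ι => H) 2) :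
    Memℓp (E := fun _ => H) (fun k => T (v k)) 2 :=
  memℓp_two_iff.2 <| .of_nonneg_of_le (fun _ => by positivity) (fun k => norm_map_sq_le T (v k))
    ((hasSum_norm_sq v).summable.mul_left _)

/-- The operator `T ⊗ 1` acting diagonally on the Hilbert sum of copies of `H`, as a linear map. -/
def amplificationₗ (T : H →L[ℂ] H) : lp (fun _ : ι => H) 2 →ₗ[ℂ] lp (fun _ : ι => H) 2 where
  toFun v := ⟨fun k => T (v k), amplification_memℓp T v⟩
  map_add' u v := by
    ext k
    exact map_add T (u k) (v k)
  map_smul' c v := by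
    ext k
    exact map_smul T c (v k)

theorem norm_amplificationₗ_le (T : H →L[ℂ] H) (v : lp (fun _ : ι => H) 2) :
    ‖amplificationₗ T v‖ ≤ ‖T‖ * ‖v‖ := by
  have h : ‖amplificationₗ T v‖ ^ 2 ≤ (‖T‖ * ‖v‖) ^ 2 := by
    rw [mul_pow]
    exact hasSum_le (fun k => norm_map_sq_le T (v k)) (hasSum_norm_sq (amplificationₗ T v))
      ((hasSum_norm_sq v).mul_left _)
  exact (sq_le_sq₀ (norm_nonneg _) (by positivity)).1 h

/-- The operator `T ⊗ 1` acting diagonally on the Hilbert sum of copies of `H`. -/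
def amplification (T : H →L[ℂ] H) : lp (fun _ : ι => H) 2 →L[ℂ] lp (fun _ : ι => H) 2 :=
  (amplificationₗ T).mkContinuous ‖T‖ (norm_amplificationₗ_le T)

@[simp]
theorem amplification_apply (T : H →L[ℂ] H) (v : lp (fun _ : ι => H) 2) (k : ι) :
    amplification T v k = T (v k) := rfl

theorem inner_amplification_left [CompleteSpace H] (T : H →L[ℂ] H) (u v : lp (fun _ : ι => H) 2) :
    inner ℂ (amplification (star T) u) v = inner ℂ u (amplification T v) := by
  rw [lp.inner_eq_tsum, lp.inner_eq_tsum]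
  refine tsum_congr fun k => ?_
  rw [amplification_apply, amplification_apply, ContinuousLinearMap.star_eq_adjoint,
    ContinuousLinearMap.adjoint_inner_left]

/-- The map `T ↦ (T ⊗ 1) v`. -/
def amplificationAt (v : lp (fun _ : ι => H) 2) : (H →L[ℂ] H) →ₗ[ℂ] lp (fun _ : ι => H) 2 where
  toFun T := amplification T v
  map_add' S T := by ext k; simp
  map_smul' c T := by ext k; simp

@[simp]
theorem amplificationAt_apply (v : lp (fun _ : ι => H) 2) (T : H →L[ℂ] H) :
    amplificationAt v T = amplification T v := rfl

/-- Von Neumann's density theorem for the ultrastrong topology, at one vector of the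
amplification. -/
theorem exists_mem_norm_amplification_lt [CompleteSpace H] (S : Subalgebra ℂ (H →L[ℂ] H))
    (hS : ∀ x ∈ S, star x ∈ S) {d : H →L[ℂ] H}
    (hd : d ∈ Set.centralizer (Set.centralizer (S : Set (H →L[ℂ] H))))
    (v : lp (fun _ : ι => H) 2) {ε : ℝ} (hε : 0 < ε) :
    ∃ x ∈ S, ‖amplification (x - d) v‖ < ε := by
  classical
  set V₀ : Submodule ℂ (lp (fun _ : ι => H) 2) :=
    S.toSubmodule.map (amplificationAt v) with hV₀
  set V := V₀.topologicalClosure with hV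
  have : CompleteSpace V := V₀.isClosed_topologicalClosure.completeSpace_coe
  have hinv : ∀ y ∈ S, ∀ u ∈ V, amplification y u ∈ V := fun y hy u hu => by
    refine map_mem_closure (amplification y).continuous hu ?_
    rintro _ ⟨x, hx, rfl⟩
    exact ⟨y * x, S.mul_mem hy hx, by ext k; simp⟩
  -- As `S` is closed under adjoints, `Vᗮ` is invariant too, so the projection onto `V` commutes
  -- with `S ⊗ 1`.
  have hcomm : ∀ y ∈ S, ∀ u, V.starProjection (amplification y u)
      = amplification y (V.starProjection u) := fun y hy u => by
    refine Submodule.eq_starProjection_of_mem_orthogonal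
      (hinv y hy _ (Submodule.starProjection_apply_mem _ _)) ?_
    rw [← map_sub, Submodule.mem_orthogonal]
    intro w hw
    rw [← inner_amplification_left]
    exact Submodule.inner_right_of_mem_orthogonal (hinv _ (hS y hy) w hw)
      (Submodule.sub_starProjection_mem_orthogonal u)
  -- The matrix entries of this projection lie in the commutant of `S`, hence commute with `d`.
  have hmat : ∀ k l, (lp.evalCLM ℂ (fun _ : ι => H) 2 k) ∘L V.starProjection ∘L
      (lp.singleContinuousLinearMap ℂ (fun _ : ι => H) 2 l) ∈
        Set.centralizer (S : Set (H →L[ℂ] H)) := by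
    intro k l y hy
    ext h
    have h1 : amplification y (lp.single 2 l h) = lp.single (E := fun _ : ι => H) 2 l (y h) := by
      ext j
      rcases eq_or_ne j l with rfl | hj
      · simp
      · simp [Pi.single_eq_of_ne hj]
    have h2 := congrArg (fun u : lp (fun _ : ι => H) 2 => u k) (hcomm y hy (lp.single 2 l h))
    rw [h1] at h2
    exact h2.symm
  -- Summing over the entries, the projection commutes with `d ⊗ 1` at `v`; it fixes `v` because `1
  -- ∈ S`.
  have hmem : amplification d v ∈ V := by
    rw [← Submodule.starProjection_eq_self_iff]
    have hv : V.starProjection v = v := by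
      rw [Submodule.starProjection_eq_self_iff]
      exact subset_closure ⟨1, S.one_mem, by ext k; simp⟩
    ext k
    have e1 := ((lp.hasSum_single (p := 2) (by simp) (amplification d v)).mapL
      ((lp.evalCLM ℂ (fun _ : ι => H) 2 k) ∘L V.starProjection))
    have e2 := ((lp.hasSum_single (p := 2) (by simp) v).mapL
      (d ∘L (lp.evalCLM ℂ (fun _ : ι => H) 2 k) ∘L V.starProjection))
    have e3 : ∀ l, d (V.starProjection (lp.single 2 l (v l)) k) =
        V.starProjection (lp.single (E := fun _ : ι => H) 2 l (d (v l))) k := fun l =>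
      (congrArg (fun T : H →L[ℂ] H => T (v l)) (hd _ (hmat k l))).symm
    have e4 := e1.unique (e2.congr_fun fun l => (e3 l).symm)
    refine e4.trans ?_
    change d (V.starProjection v k) = d (v k)
    rw [hv]
  obtain ⟨_, ⟨x, hx, rfl⟩, hlt⟩ := Metric.mem_closure_iff.1 hmem ε hε
  refine ⟨x, hx, ?_⟩
  rw [dist_comm, dist_eq_norm] at hlt
  rwa [← amplificationAt_apply, map_sub]

end Density

/-! ### The 2-norm of a tracial state and a uniform Kaplansky theorem. -/

section TracialState

variable {A : Type*} [CStarAlgebra A]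

/-- A tracial state on a `C*`-algebra. -/
structure IsTracialState (φ : A →ₗ[ℂ] ℂ) : Prop where
  map_one : φ 1 = 1
  nonneg : ∀ x, 0 ≤ (φ (star x * x)).re
  tracial : ∀ x y, φ (x * y) = φ (y * x)

/-- The square of the `2`-norm associated with a tracial state. -/
def sqNorm (φ : A →ₗ[ℂ] ℂ) (x : A) : ℝ := (φ (star x * x)).re

variable {φ : A →ₗ[ℂ] ℂ}

theorem sqNorm_zero : sqNorm φ 0 = 0 := by simp [sqNorm]

theorem sqNorm_neg (x : A) : sqNorm φ (-x) = sqNorm φ x := by simp [sqNorm]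

theorem sqNorm_smul (c : ℝ) (x : A) : sqNorm φ (c • x) = c ^ 2 * sqNorm φ x := by
  have h : star (c • x) * (c • x) = ((c ^ 2 : ℝ) : ℂ) • (star x * x) := by
    rw [star_smul, star_trivial, smul_mul_smul_comm, ← sq]
    exact (RCLike.real_smul_eq_coe_smul (K := ℂ) _ _)
  rw [sqNorm, h, map_smul, smul_eq_mul, Complex.re_ofReal_mul, sqNorm]

namespace IsTracialState

variable (hφ : IsTracialState φ)
include hφ

theorem sqNorm_nonneg (x : A) : 0 ≤ sqNorm φ x := hφ.nonneg x

theorem sqNorm_star (x : A) : sqNorm φ (star x) = sqNorm φ x := by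
  rw [sqNorm, star_star, hφ.tracial, sqNorm]

theorem sqNorm_add_le (x y : A) : sqNorm φ (x + y) ≤ 2 * sqNorm φ x + 2 * sqNorm φ y := by
  have h := hφ.sqNorm_nonneg (x - y)
  have e : sqNorm φ (x + y) + sqNorm φ (x - y) = 2 * sqNorm φ x + 2 * sqNorm φ y := by
    simp only [sqNorm, star_add, star_sub, add_mul, mul_add, sub_mul, mul_sub, map_add, map_sub,
      Complex.add_re, Complex.sub_re]
    ring
  linarith

/-- Since `‖x‖² - x*x = z*z` for some `z`, this is positivity of `φ` at `z y`. -/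
theorem sqNorm_mul_le (x y : A) : sqNorm φ (x * y) ≤ ‖x‖ ^ 2 * sqNorm φ y := by
  let _ := CStarAlgebra.spectralOrder A
  let _ := CStarAlgebra.spectralOrderedRing A
  have h1 : star x * x ≤ algebraMap ℝ A (‖x‖ ^ 2) := by
    refine (IsSelfAdjoint.le_algebraMap_norm_self (.star_mul_self x)).trans_eq ?_
    rw [CStarRing.norm_star_mul_self, sq]
  obtain ⟨z, hz⟩ := CStarAlgebra.nonneg_iff_eq_star_mul_self.1 (sub_nonneg.2 h1)
  have h2 := hφ.nonneg (z * y)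
  have e : star (z * y) * (z * y) =
      ((‖x‖ ^ 2 : ℝ) : ℂ) • (star y * y) - star (x * y) * (x * y) := by
    have : star (z * y) * (z * y) = star y * (star z * z) * y := by
      rw [star_mul]; noncomm_ring
    rw [this, ← hz, mul_sub, sub_mul, star_mul, ← Algebra.commutes, mul_assoc, ← Algebra.smul_def,
      mul_assoc, mul_assoc, mul_assoc, RCLike.real_smul_eq_coe_smul (K := ℂ)]
    rfl
  rw [e, map_sub, map_smul, smul_eq_mul, Complex.sub_re, Complex.re_ofReal_mul] at h2
  exact sub_nonneg.1 h2

/-- Traciality enters here, through the invariance of the 2-norm under `star`. -/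
theorem sqNorm_mul_le' (x y : A) : sqNorm φ (x * y) ≤ ‖y‖ ^ 2 * sqNorm φ x := by
  rw [← hφ.sqNorm_star, star_mul, ← hφ.sqNorm_star x, ← norm_star y]
  exact hφ.sqNorm_mul_le _ _

theorem sqNorm_le (x : A) : sqNorm φ x ≤ ‖x‖ ^ 2 := by
  have := hφ.sqNorm_mul_le x 1
  rwa [mul_one, sqNorm, sqNorm, star_one, one_mul, hφ.map_one, Complex.one_re, mul_one] at this

theorem sq_re_le {x : A} (hx : IsSelfAdjoint x) : (φ x).re ^ 2 ≤ sqNorm φ x := by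
  -- Positivity of the variance, `φ((x - t)²) ≥ 0`.
  set t := (φ x).re with ht
  have h := hφ.nonneg (x - (t : ℂ) • 1)
  have e : star (x - (t : ℂ) • 1) * (x - (t : ℂ) • 1) =
      star x * x - (t : ℂ) • x - (t : ℂ) • x + (t : ℂ) • (t : ℂ) • (1 : A) := by
    simp only [star_sub, star_smul, star_one, hx.star_eq, Complex.star_def, Complex.conj_ofReal,
      sub_mul, mul_sub, smul_mul_assoc, mul_smul_comm, one_mul, mul_one, smul_sub]
    abel
  rw [e, map_add, map_sub, map_sub, map_smul, map_smul, map_smul, hφ.map_one] at h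
  simp only [smul_eq_mul, mul_one, Complex.add_re, Complex.sub_re, Complex.re_ofReal_mul,
    Complex.ofReal_re, ← ht] at h
  rw [sqNorm]
  nlinarith

theorem sqNorm_cfcDivOneAddSq_sub_le {x y : A} (hx : IsSelfAdjoint x) (hy : IsSelfAdjoint y) :
    sqNorm φ (cfcDivOneAddSq x - cfcDivOneAddSq y) ≤ 3 * sqNorm φ (x - y) := by
  obtain ⟨u, v, hu, hv, e⟩ := exists_cfcDivOneAddSq_sub x y hx hy
  -- Used with `r = 1` and `r = 1 / 2`: the constant is `2 + 2 / 16 ≤ 3`.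
  have key : ∀ (a b : A) (r : ℝ), 0 ≤ r → ‖a‖ ≤ r → ‖b‖ ≤ r →
      sqNorm φ (a * (x - y) * b) ≤ r ^ 4 * sqNorm φ (x - y) := fun a b r hr ha hb => by
    have h0 := hφ.sqNorm_nonneg (x - y)
    have ha2 : ‖a‖ ^ 2 ≤ r ^ 2 := pow_le_pow_left₀ (norm_nonneg _) ha 2
    have hb2 : ‖b‖ ^ 2 ≤ r ^ 2 := pow_le_pow_left₀ (norm_nonneg _) hb 2
    calc _ ≤ ‖b‖ ^ 2 * sqNorm φ (a * (x - y)) := hφ.sqNorm_mul_le' _ _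
      _ ≤ r ^ 2 * sqNorm φ (a * (x - y)) := mul_le_mul_of_nonneg_right hb2 (hφ.sqNorm_nonneg _)
      _ ≤ r ^ 2 * (‖a‖ ^ 2 * sqNorm φ (x - y)) :=
        mul_le_mul_of_nonneg_left (hφ.sqNorm_mul_le _ _) (by positivity)
      _ ≤ r ^ 2 * (r ^ 2 * sqNorm φ (x - y)) := by gcongr
      _ = _ := by ring
  have h1 := key u v 1 zero_le_one hu hv
  have h2 := key _ _ (1 / 2) (by norm_num) (norm_cfcDivOneAddSq_le x) (norm_cfcDivOneAddSq_le y)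
  have h3 := hφ.sqNorm_add_le (u * (x - y) * v)
    (-(cfcDivOneAddSq x * (x - y) * cfcDivOneAddSq y))
  rw [← sub_eq_add_neg, ← e, sqNorm_neg] at h3
  have h4 := hφ.sqNorm_nonneg (x - y)
  linarith

end IsTracialState

/-- A norm-bounded sequence converging in the `2`-norm of a tracial state. -/
def BoundedTendsto (φ : A →ₗ[ℂ] ℂ) (x : ℕ → A) (y : A) : Prop :=
  (∃ K, ∀ m, ‖x m‖ ≤ K) ∧ Tendsto (fun m => sqNorm φ (x m - y)) atTop (nhds 0)

namespace BoundedTendsto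

theorem const (φ : A →ₗ[ℂ] ℂ) (y : A) : BoundedTendsto φ (fun _ => y) y :=
  ⟨⟨‖y‖, fun _ => le_rfl⟩, by simp [sqNorm_zero]⟩

variable (hφ : IsTracialState φ) {x x' : ℕ → A} {y y' : A}
include hφ

theorem add (h : BoundedTendsto φ x y) (h' : BoundedTendsto φ x' y') :
    BoundedTendsto φ (fun m => x m + x' m) (y + y') := by
  obtain ⟨⟨K, hK⟩, hx⟩ := h
  obtain ⟨⟨K', hK'⟩, hx'⟩ := h'
  refine ⟨⟨K + K', fun m => (norm_add_le _ _).trans (add_le_add (hK m) (hK' m))⟩, ?_⟩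
  have hlim := (hx.const_mul 2).add (hx'.const_mul 2)
  rw [mul_zero, add_zero] at hlim
  refine squeeze_zero (fun m => hφ.sqNorm_nonneg _) (fun m => ?_) hlim
  rw [add_sub_add_comm]
  exact hφ.sqNorm_add_le _ _

/-- The norm bound makes multiplication 2-norm continuous: `x x' - y y' = x (x' - y') + (x - y) y'`.
-/
theorem mul (h : BoundedTendsto φ x y) (h' : BoundedTendsto φ x' y') :
    BoundedTendsto φ (fun m => x m * x' m) (y * y') := by
  obtain ⟨⟨K, hK⟩, hx⟩ := h
  obtain ⟨⟨K', hK'⟩, hx'⟩ := h'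
  refine ⟨⟨K * K', fun m => (norm_mul_le _ _).trans
    (mul_le_mul (hK m) (hK' m) (norm_nonneg _) ((norm_nonneg _).trans (hK m)))⟩, ?_⟩
  have hlim := (hx'.const_mul (2 * K ^ 2)).add (hx.const_mul (2 * ‖y'‖ ^ 2))
  rw [mul_zero, mul_zero, add_zero] at hlim
  refine squeeze_zero (fun m => hφ.sqNorm_nonneg _) (fun m => ?_) hlim
  have e : x m * x' m - y * y' = x m * (x' m - y') + (x m - y) * y' := by noncomm_ring
  rw [e, mul_assoc, mul_assoc]
  refine (hφ.sqNorm_add_le _ _).trans (add_le_add ?_ ?_)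
  · refine mul_le_mul_of_nonneg_left ((hφ.sqNorm_mul_le _ _).trans ?_) zero_le_two
    exact mul_le_mul_of_nonneg_right (pow_le_pow_left₀ (norm_nonneg _) (hK m) 2)
      (hφ.sqNorm_nonneg _)
  · exact mul_le_mul_of_nonneg_left (hφ.sqNorm_mul_le' _ _) zero_le_two

theorem evalHom {N : ℕ} {x : ℕ → Fin N → A} {y : Fin N → A}
    (h : ∀ i, BoundedTendsto φ (fun m => x m i) (y i)) (p : NCPoly N) :
    BoundedTendsto φ (fun m => NCPoly.evalHom (x m) p) (NCPoly.evalHom y p) := by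
  induction p using MonoidAlgebra.induction_linear with
  | zero => simpa using const φ 0
  | add p q hp hq => simpa only [map_add] using hp.add hφ hq
  | single w c =>
    have hw : BoundedTendsto φ (fun m => FreeMonoid.lift (x m) w) (FreeMonoid.lift y w) := by
      induction w using FreeMonoid.inductionOn' with
      | one => simpa using const φ 1
      | of_mul i w ih =>
        simpa only [map_mul, FreeMonoid.lift_eval_of] using (h i).mul hφ ih
    simpa [NCPoly.evalHom_single] using (const φ (c • 1)).mul hφ hw

theorem tendsto_re (h : BoundedTendsto φ x y) (hx : ∀ m, IsSelfAdjoint (x m))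
    (hy : IsSelfAdjoint y) : Tendsto (fun m => (φ (x m)).re) atTop (nhds (φ y).re) := by
  rw [tendsto_iff_norm_sub_tendsto_zero]
  have hlim := h.2.sqrt
  rw [Real.sqrt_zero] at hlim
  refine squeeze_zero (fun m => norm_nonneg _) (fun m => ?_) hlim
  rw [Real.norm_eq_abs, ← Complex.sub_re, ← map_sub]
  exact Real.abs_le_sqrt (hφ.sq_re_le ((hx m).sub hy))

end BoundedTendsto

/-- A certificate that `‖p(x_1, …, x_N)‖ ≤ C` for all selfadjoint elements `x_1, …, x_N` of norm at
most `R` of any `C*`-algebra. -/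
def NCPoly.UniformlyBounded {N : ℕ} (R C : ℝ) (p : NCPoly N) : Prop :=
  ∃ (s : NCPoly N) (h : Polynomial ℝ), IsSelfAdjoint s ∧ p = realAeval s h ∧
    ∀ t ∈ Set.Icc (-NCPoly.coeffBound R s) (NCPoly.coeffBound R s), |h.eval t| ≤ C

theorem CStarAlgebra.norm_one_le : ‖(1 : A)‖ ≤ 1 := by
  nontriviality A
  simp

namespace NCPoly.UniformlyBounded

variable {N : ℕ} {R C : ℝ} {p : NCPoly N}

theorem zero (hC : 0 ≤ C) : UniformlyBounded R C (0 : NCPoly N) :=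
  ⟨0, 0, .zero _, by simp [realAeval], fun t _ => by simpa using hC⟩

theorem isSelfAdjoint (hp : UniformlyBounded R C p) : IsSelfAdjoint p := by
  obtain ⟨s, h, hs, rfl, -⟩ := hp
  exact hs.realAeval h

/-- The spectrum of `s(x)` lies in the interval where `|h| ≤ C`, whatever the algebra. One
certificate thus serves `M` and matrices of all sizes. -/
theorem norm_evalHom_le (hp : UniformlyBounded R C p) (hC : 0 ≤ C) {x : Fin N → A}
    (hx : ∀ i, IsSelfAdjoint (x i)) (hR : ∀ i, ‖x i‖ ≤ R) : ‖evalHom x p‖ ≤ C := by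
  obtain ⟨s, h, hs, rfl, hh⟩ := hp
  rw [map_realAeval]
  exact norm_realAeval_le (isSelfAdjoint_evalHom hx hs)
    (NCPoly.norm_evalHom_le CStarAlgebra.norm_one_le hR s) hC hh

end NCPoly.UniformlyBounded

/-- Take the real part of `p`: `d` is selfadjoint and `star` preserves the 2-norm, so the error does
not grow. -/
theorem IsTracialState.exists_isSelfAdjoint_near (hφ : IsTracialState φ) {N : ℕ} {x : Fin N → A}
    (hx : ∀ j, IsSelfAdjoint (x j)) {d : A} (hd : IsSelfAdjoint d) {i : Fin N} {p : NCPoly N}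
    (hp : p ∈ NCPoly.below i) :
    ∃ s ∈ NCPoly.below i, IsSelfAdjoint s ∧
      sqNorm φ (NCPoly.evalHom x s - d) ≤ sqNorm φ (NCPoly.evalHom x p - d) := by
  have hmem : p + star p ∈ NCPoly.below i :=
    (NCPoly.below i).add_mem hp (NCPoly.star_mem_below hp)
  have hsa : IsSelfAdjoint (p + star p) := IsSelfAdjoint.add_star_self p
  refine ⟨(2⁻¹ : ℂ) • (p + star p), (NCPoly.below i).smul_mem hmem _,
    IsSelfAdjoint.smul (by simp [isSelfAdjoint_iff]) hsa, ?_⟩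
  set w := NCPoly.evalHom x p - d with hw
  have e : NCPoly.evalHom x ((2⁻¹ : ℂ) • (p + star p)) - d = (2⁻¹ : ℝ) • (w + star w) := by
    have h1 : d = (2⁻¹ : ℂ) • (d + d) := by
      rw [← two_smul ℂ d, smul_smul, inv_mul_cancel₀ two_ne_zero, one_smul]
    have h2 : (2⁻¹ : ℝ) • (w + star w) = (2⁻¹ : ℂ) • (w + star w) := by
      rw [RCLike.real_smul_eq_coe_smul (K := ℂ)]
      norm_num
    rw [h2, map_smul, map_add, ← NCPoly.star_evalHom hx, hw, star_sub, hd.star_eq,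
      sub_add_sub_comm, smul_sub _ _ (d + d), ← h1]
  rw [e, sqNorm_smul]
  have := hφ.sqNorm_add_le w (star w)
  rw [hφ.sqNorm_star] at this
  linarith

theorem IsTracialState.exists_realAeval_near (hφ : IsTracialState φ) {x d : A}
    (hx : IsSelfAdjoint x) (hd : IsSelfAdjoint d) {L C ε : ℝ} (hL : ‖x‖ ≤ L) (hC : 0 < C)
    (hε : 0 < ε) (hxd : sqNorm φ (x - d) < ε / (48 * C ^ 2)) :
    ∃ h : Polynomial ℝ, (∀ t ∈ Set.Icc (-L) L, |h.eval t| ≤ C) ∧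
      sqNorm φ (realAeval x h - C • (2 : ℝ) • cfcDivOneAddSq d) < ε := by
  -- The error splits into `2δ² ≤ ε / 4` and `2 · 4C² · 3 · ε / (48C²) = ε / 2`.
  set δ := min 1 (ε / 8) with hδ
  have hδ0 : 0 < δ := lt_min one_pos (by positivity)
  obtain ⟨h, hhC, hhδ⟩ := exists_polynomial_near_cfcDivOneAddSq L hC hδ0
  refine ⟨h, hhC, ?_⟩
  have h1 := norm_realAeval_sub_cfcDivOneAddSq_le hx hL hδ0.le hhδ
  have h2 := hφ.sqNorm_cfcDivOneAddSq_sub_le hx hd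
  have e : realAeval x h - C • (2 : ℝ) • cfcDivOneAddSq d =
      (realAeval x h - C • (2 : ℝ) • cfcDivOneAddSq x) +
        C • (2 : ℝ) • (cfcDivOneAddSq x - cfcDivOneAddSq d) := by
    rw [smul_sub, smul_sub]
    abel
  rw [e]
  refine (hφ.sqNorm_add_le _ _).trans_lt ?_
  rw [sqNorm_smul, sqNorm_smul]
  have h3 := (hφ.sqNorm_le _).trans (pow_le_pow_left₀ (norm_nonneg _) h1 2)
  have h4 : δ ^ 2 ≤ ε / 8 := by
    have h5 : δ ≤ 1 := min_le_left _ _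
    have h6 : δ ≤ ε / 8 := min_le_right _ _
    nlinarith
  have h7 : C ^ 2 * sqNorm φ (x - d) ≤ ε / 48 := by
    calc _ ≤ C ^ 2 * (ε / (48 * C ^ 2)) := by gcongr
      _ = ε / 48 := by field_simp
  have h8 : C ^ 2 * sqNorm φ (cfcDivOneAddSq x - cfcDivOneAddSq d) ≤
      C ^ 2 * (3 * sqNorm φ (x - d)) := by gcongr
  linarith

/-- A form of Kaplansky's density theorem for the `2`-norm, with approximants bounded uniformly
over all `C*`-algebras. -/
theorem IsTracialState.exists_uniformlyBounded_near (hφ : IsTracialState φ) {N : ℕ} {x : Fin N → A}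
    (hx : ∀ j, IsSelfAdjoint (x j)) {R C : ℝ} (hR : ∀ j, ‖x j‖ ≤ R) {c : A}
    (hc : IsSelfAdjoint c) (hcC : ‖c‖ ≤ C) (i : Fin N)
    (hdense : ∀ (k : ℝ) (g : ℝ → ℝ), ContinuousOn g (spectrum ℝ (k • c)) → ∀ ε > 0,
      ∃ p ∈ NCPoly.below i, sqNorm φ (NCPoly.evalHom x p - cfc g (k • c)) < ε)
    {ε : ℝ} (hε : 0 < ε) :
    ∃ p ∈ NCPoly.below i, NCPoly.UniformlyBounded R C p ∧
      sqNorm φ (NCPoly.evalHom x p - c) < ε := by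
  rcases ((norm_nonneg c).trans hcC).eq_or_lt with rfl | hC
  · have : c = 0 := norm_le_zero_iff.1 hcC
    exact ⟨0, zero_mem _, .zero le_rfl, by simpa [this, sqNorm_zero] using hε⟩
  obtain ⟨g, hg, hgc⟩ := exists_cfcDivOneAddSq_eq (C⁻¹ • c) (.smul (.all _) hc) (by
    rw [norm_smul, Real.norm_eq_abs, abs_of_pos (inv_pos.2 hC), inv_mul_le_iff₀ hC, mul_one]
    exact hcC)
  set d := cfc g (C⁻¹ • c) with hd
  have hds : IsSelfAdjoint d := cfc_predicate _ _
  have hcd : C • (2 : ℝ) • cfcDivOneAddSq d = c := by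
    rw [hgc, smul_smul, mul_inv_cancel₀ hC.ne', one_smul]
  -- No control of `‖p₀(a)‖` is available or needed: `h` restores the bound `C` afterwards.
  obtain ⟨p₀, hp₀, hlt⟩ := hdense C⁻¹ g hg (ε / (48 * C ^ 2)) (by positivity)
  obtain ⟨s, hsmem, hss, hle⟩ := hφ.exists_isSelfAdjoint_near hx hds hp₀
  obtain ⟨h, hhC, hh⟩ := hφ.exists_realAeval_near (NCPoly.isSelfAdjoint_evalHom hx hss) hds
    (NCPoly.norm_evalHom_le CStarAlgebra.norm_one_le hR s) hC hε (hle.trans_lt hlt)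
  refine ⟨realAeval s h, realAeval_mem hsmem h, ⟨s, h, hss, rfl, hhC⟩, ?_⟩
  rwa [map_realAeval, ← hcd]

end TracialState

/-! ### Polynomial approximation in a von Neumann algebra with a normal trace. -/

section VonNeumann

variable {H : Type*} [NormedAddCommGroup H] [InnerProductSpace ℂ H] [CompleteSpace H]

/-- Norm closedness makes `M` a `C*`-algebra, which gives it a functional calculus. -/
instance VonNeumannAlgebra.isClosed_toStarSubalgebra (M : VonNeumannAlgebra H) :
    IsClosed (M.toStarSubalgebra : Set (H →L[ℂ] H)) := by
  rw [VonNeumannAlgebra.coe_toStarSubalgebra, ← VonNeumannAlgebra.centralizer_centralizer]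
  exact Set.isClosed_centralizer _

variable {M : VonNeumannAlgebra H}

theorem coe_cfc_toStarSubalgebra (g : ℝ → ℝ) (c : M.toStarSubalgebra) (hc : IsSelfAdjoint c)
    (hg : ContinuousOn g (spectrum ℝ c)) :
    ((cfc g c : M.toStarSubalgebra) : H →L[ℂ] H) = cfc g (c : H →L[ℂ] H) :=
  StarAlgHomClass.map_cfc (S := ℂ) M.toStarSubalgebra.subtype g c hg continuous_subtype_val hc
    (hc.map M.toStarSubalgebra.subtype)

theorem cfc_mem_centralizer_centralizer {S : Set (H →L[ℂ] H)} {c : H →L[ℂ] H}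
    (hc : c ∈ Set.centralizer (Set.centralizer S)) (g : ℝ → ℝ) :
    cfc g c ∈ Set.centralizer (Set.centralizer S) := fun y hy =>
  ((show Commute c y from (hc y hy).symm).cfc_real g).symm

variable (τ : FaithfulNormalTrace M)

theorem FaithfulNormalTrace.isTracialState : IsTracialState τ.toLinearMap where
  map_one := τ.map_one
  nonneg x := (Complex.nonneg_iff.1 (τ.nonneg x)).1
  tracial := τ.tracial

/-- Normality gives `τ(x*x) = ∑ ⟪x ξ_k, x ζ_k⟫`, whose terms are bounded by `‖x ξ_k‖² + ‖x ζ_k‖²`.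
Listing `ξ` and `ζ` as one vector reduces 2-norm density to density at that vector. -/
theorem FaithfulNormalTrace.exists_sqNorm_le :
    ∃ v : lp (fun _ : ℕ ⊕ ℕ => H) 2, ∀ x : M.toStarSubalgebra,
      sqNorm τ.toLinearMap x ≤ ‖amplification (x : H →L[ℂ] H) v‖ ^ 2 := by
  obtain ⟨ξ, ζ, hξ, hζ, h⟩ := τ.normal
  have hv : Memℓp (E := fun _ : ℕ ⊕ ℕ => H) (Sum.elim ξ ζ) 2 := by
    rw [memℓp_two_iff]
    exact (HasSum.sum (f := fun k => ‖Sum.elim ξ ζ k‖ ^ 2) hξ.hasSum hζ.hasSum).summable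
  refine ⟨⟨_, hv⟩, fun x => ?_⟩
  set T : H →L[ℂ] H := x.1 with hT
  have h1 := Complex.hasSum_re (h (star x * x))
  have h2 := hasSum_norm_sq (amplification T ⟨_, hv⟩)
  have hl := h2.summable.comp_injective (Sum.inl_injective (α := ℕ) (β := ℕ))
  have hr := h2.summable.comp_injective (Sum.inr_injective (α := ℕ) (β := ℕ))
  have h3 := h2.unique (HasSum.sum hl.hasSum hr.hasSum)
  rw [h3]
  refine hasSum_le (fun k => ?_) h1 (hl.hasSum.add hr.hasSum)
  have e : inner ℂ (ξ k) (((star x * x : M.toStarSubalgebra) : H →L[ℂ] H) (ζ k)) =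
      inner ℂ (T (ξ k)) (T (ζ k)) := by
    rw [← ContinuousLinearMap.adjoint_inner_right]
    rfl
  rw [e]
  have h4 := re_inner_le_norm (𝕜 := ℂ) (T (ξ k)) (T (ζ k))
  have h5 := two_mul_le_add_sq ‖T (ξ k)‖ ‖T (ζ k)‖
  have h6 : (inner ℂ (T (ξ k)) (T (ζ k))).re ≤ ‖T (ξ k)‖ ^ 2 + ‖T (ζ k)‖ ^ 2 := by
    have := mul_nonneg (norm_nonneg (T (ξ k))) (norm_nonneg (T (ζ k)))
    exact h4.trans (by linarith)
  exact h6

theorem FaithfulNormalTrace.exists_sqNorm_evalHom_sub_lt {N : ℕ} {a : Fin N → M.toStarSubalgebra}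
    (ha : ∀ i, IsSelfAdjoint (a i)) (i : Fin N) {d : M.toStarSubalgebra}
    (hd : (d : H →L[ℂ] H) ∈
        Set.centralizer (Set.centralizer ((fun j => (a j : H →L[ℂ] H)) '' Set.Iio i)))
    {ε : ℝ} (hε : 0 < ε) :
    ∃ p ∈ NCPoly.below i, sqNorm τ.toLinearMap (NCPoly.evalHom a p - d) < ε := by
  obtain ⟨v, hv⟩ := τ.exists_sqNorm_le
  let S : Subalgebra ℂ (H →L[ℂ] H) := (NCPoly.below i).map
    (M.toStarSubalgebra.subtype.toAlgHom.comp (NCPoly.evalHom a))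
  have hS : ∀ x ∈ S, star x ∈ S := by
    rintro _ ⟨p, hp, rfl⟩
    refine ⟨star p, NCPoly.star_mem_below hp, ?_⟩
    change ((NCPoly.evalHom a (star p) : M.toStarSubalgebra) : H →L[ℂ] H) = _
    rw [← NCPoly.star_evalHom ha]
    rfl
  have hdS : (d : H →L[ℂ] H) ∈ Set.centralizer (Set.centralizer (S : Set (H →L[ℂ] H))) := by
    refine Set.centralizer_subset (Set.centralizer_subset ?_) hd
    rintro _ ⟨j, hj, rfl⟩
    refine ⟨NCPoly.X j, Algebra.subset_adjoin ⟨j, hj, rfl⟩, ?_⟩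
    change ((NCPoly.evalHom a (NCPoly.X j) : M.toStarSubalgebra) : H →L[ℂ] H) = _
    rw [NCPoly.evalHom_X]
  obtain ⟨_, ⟨p, hp, rfl⟩, hlt⟩ := exists_mem_norm_amplification_lt S hS hdS v (Real.sqrt_pos.2 hε)
  refine ⟨p, hp, (hv _).trans_lt ?_⟩
  exact (Real.lt_sqrt (norm_nonneg _)).1 hlt

theorem FaithfulNormalTrace.exists_uniformlyBounded_near {N : ℕ} {a : Fin N → M.toStarSubalgebra}
    (ha : ∀ i, IsSelfAdjoint (a i)) {R C : ℝ} (hR : ∀ j, ‖a j‖ ≤ R) (i : Fin N)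
    {c : M.toStarSubalgebra} (hc : IsSelfAdjoint c) (hcC : ‖c‖ ≤ C)
    (hmem : (c : H →L[ℂ] H) ∈
        Set.centralizer (Set.centralizer ((fun j => (a j : H →L[ℂ] H)) '' Set.Iio i)))
    {ε : ℝ} (hε : 0 < ε) :
    ∃ p ∈ NCPoly.below i, NCPoly.UniformlyBounded R C p ∧
      sqNorm τ.toLinearMap (NCPoly.evalHom a p - c) < ε := by
  refine τ.isTracialState.exists_uniformlyBounded_near ha hR hc hcC i (fun k g hg ε hε => ?_) hε
  refine τ.exists_sqNorm_evalHom_sub_lt ha i ?_ hε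
  rw [coe_cfc_toStarSubalgebra g _ (.smul (.all _) hc) hg]
  refine cfc_mem_centralizer_centralizer (fun y hy => ?_) g
  change y * (k • (c : H →L[ℂ] H)) = k • (c : H →L[ℂ] H) * y
  rw [mul_smul_comm, smul_mul_assoc, hmem y hy]

end VonNeumann

/-! ### Triangular shears preserve product measures. -/

section Shear

variable {G : Type*} [AddCommGroup G] [MeasurableSpace G] [MeasurableAdd₂ G]
  (μ : Measure G) [SigmaFinite μ] [μ.IsAddLeftInvariant]

theorem measurePreserving_prod_add {Y : Type*} [MeasurableSpace Y] (ν : Measure Y) [SigmaFinite ν]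
    {f : Y → G} (hf : Measurable f) :
    MeasurePreserving (fun z : G × Y => (z.1 + f z.2, z.2)) (μ.prod ν) (μ.prod ν) := by
  have h : MeasurePreserving (fun z : Y × G => (z.1, f z.1 + z.2)) (ν.prod μ) (ν.prod μ) :=
    (MeasurePreserving.id ν).skew_product (g := fun y x => f y + x)
      ((hf.comp measurable_fst).add measurable_snd)
      (.of_forall fun y => map_add_left_eq_self μ (f y))
  have h2 := Measure.measurePreserving_swap.comp
    (h.comp (Measure.measurePreserving_swap (μ := μ) (ν := ν)))
  convert h2 using 2 with z
  simp [add_comm]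

theorem measurePreserving_update_add {N : ℕ} (i : Fin N) {f : (Fin N → G) → G} (hf : Measurable f)
    (hfi : ∀ A z, f (Function.update A i z) = f A) :
    MeasurePreserving (fun A => Function.update A i (A i + f A))
      (Measure.pi fun _ : Fin N => μ) (Measure.pi fun _ : Fin N => μ) := by
  obtain _ | m := N
  · exact i.elim0
  have he := measurePreserving_piFinSuccAbove (fun _ : Fin (m + 1) => μ) i
  have hm := measurePreserving_prod_add μ (Measure.pi fun _ : Fin m => μ)
    (f := fun y => f ((MeasurableEquiv.piFinSuccAbove (fun _ => G) i).symm (0, y)))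
    (hf.comp ((MeasurableEquiv.measurable _).comp (by fun_prop)))
  have h2 := (he.symm _).comp (hm.comp he)
  convert h2 using 2 with A
  ext j
  refine Fin.succAboveCases i ?_ (fun j => ?_) j
  · simp [MeasurableEquiv.piFinSuccAbove, Fin.insertNthEquiv]
    rw [← hfi A 0]
  · simp [MeasurableEquiv.piFinSuccAbove, Fin.insertNthEquiv, Fin.removeNth]

theorem measurePreserving_triangular_add {N : ℕ} {f : Fin N → (Fin N → G) → G}
    (hf : ∀ i, Measurable (f i)) (hfi : ∀ i A B, (∀ j < i, A j = B j) → f i A = f i B) :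
    MeasurePreserving (fun A i => A i + f i A)
      (Measure.pi fun _ : Fin N => μ) (Measure.pi fun _ : Fin N => μ) := by
  -- After `j` elementary shears the last `j` coordinates have been translated. Going from last to
  -- first, each `f k` still reads unchanged coordinates.
  have key : ∀ j : ℕ, MeasurePreserving
      (fun (A : Fin N → G) (i : Fin N) => if N ≤ i + j then A i + f i A else A i)
      (Measure.pi fun _ : Fin N => μ) (Measure.pi fun _ : Fin N => μ) := by
    intro j
    induction j with
    | zero =>
      convert MeasurePreserving.id _ using 1
      ext A i
      simp [i.2]
    | succ j ih =>
      rcases lt_or_ge j N with hj | hj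
      · set k : Fin N := ⟨N - (j + 1), by omega⟩ with hk
        have hS := measurePreserving_update_add μ k (hf k) fun A z =>
          hfi k _ _ fun l hl => Function.update_of_ne hl.ne _ _
        convert hS.comp ih using 1
        ext A i
        have h1 : f k (fun i => if N ≤ i + j then A i + f i A else A i) = f k A :=
          hfi k _ _ fun l hl => if_neg (by
            have : l.val < k.val := hl
            simp only [hk] at this
            omega)
        rcases eq_or_ne i k with rfl | hi
        · simp only [Function.comp_apply, Function.update_self, h1]
          rw [if_pos (by simp only [hk]; omega), if_neg (by simp only [hk]; omega)]
        · have hi' : i.val ≠ N - (j + 1) := fun h => hi (Fin.ext h)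
          simp only [Function.comp_apply, Function.update_of_ne hi]
          exact if_congr (by omega) rfl rfl
      · convert ih using 3 with A i
        exact if_congr (by omega) rfl rfl
  convert key N using 3 with A i
  simp

end Shear

/-! ### Matrix integrals and the effect of a shear on the free pressure. -/

section Matrices

variable {n N : ℕ}

instance MatSA.continuousSMul : ContinuousSMul ℝ (MatSA n) where
  continuous_smul := by
    refine Continuous.subtype_mk ?_ _
    exact continuous_fst.smul (continuous_subtype_val.comp continuous_snd)

/-- The real coordinates of a selfadjoint matrix; inverse to `MatSA.ofCoords`. -/
def MatSA.coords (A : MatSA n) (i j : Fin n) : ℝ :=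
  if i ≤ j then ((A : Matrix (Fin n) (Fin n) ℂ) i j).re
  else ((A : Matrix (Fin n) (Fin n) ℂ) j i).im

theorem MatSA.ofCoords_apply (x : Fin n → Fin n → ℝ) (i j : Fin n) :
    (MatSA.ofCoords n x : Matrix (Fin n) (Fin n) ℂ) i j =
      if i = j then (x i i : ℂ)
      else if i < j then (x i j : ℂ) + (x j i : ℂ) * Complex.I
      else (x j i : ℂ) - (x i j : ℂ) * Complex.I := rfl

theorem MatSA.coords_ofCoords (x : Fin n → Fin n → ℝ) :
    MatSA.coords (MatSA.ofCoords n x) = x := by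
  ext i j
  rw [coords, ofCoords_apply, ofCoords_apply]
  rcases lt_trichotomy i j with h | rfl | h
  · simp [h.le, h.ne, h]
  · simp
  · simp [h.not_ge, h.ne, h]

theorem MatSA.ofCoords_coords (A : MatSA n) : MatSA.ofCoords n (MatSA.coords A) = A := by
  have hA : ∀ i j, star ((A : Matrix (Fin n) (Fin n) ℂ) j i) =
      (A : Matrix (Fin n) (Fin n) ℂ) i j := fun i j => congrFun (congrFun A.2 i) j
  ext i j
  rw [ofCoords_apply, coords, coords, coords]
  rcases lt_trichotomy i j with h | rfl | h
  · simp [h.le, h.ne, h, h.not_ge, Complex.re_add_im]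
  · have := hA i i
    simp only [le_refl, if_true]
    exact Complex.conj_eq_iff_re.1 this
  · rw [← hA i j, if_neg h.ne', if_neg h.not_gt, if_pos h.le, if_neg h.not_ge]
    apply Complex.ext <;> simp

/-- `MatSA.ofCoords` as a linear homeomorphism. -/
def MatSA.coordsEquiv (n : ℕ) : (Fin n → Fin n → ℝ) ≃L[ℝ] MatSA n where
  toFun := MatSA.ofCoords n
  invFun := MatSA.coords
  left_inv := MatSA.coords_ofCoords
  right_inv := MatSA.ofCoords_coords
  map_add' x y := by
    ext i j
    simp only [AddSubgroup.coe_add, Matrix.add_apply, ofCoords_apply, Pi.add_apply]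
    split_ifs <;> push_cast <;> ring
  map_smul' c x := by
    ext i j
    simp only [RingHom.id_apply, selfAdjoint.val_smul, Matrix.smul_apply, ofCoords_apply,
      Pi.smul_apply, smul_eq_mul, Complex.real_smul]
    split_ifs <;> push_cast <;> ring
  continuous_toFun := by
    refine Continuous.subtype_mk (continuous_matrix fun i j => ?_) _
    simp only [Matrix.of_apply]
    split_ifs <;> fun_prop
  continuous_invFun := by
    refine continuous_pi fun i => continuous_pi fun j => ?_
    have h : ∀ i j, Continuous fun A : MatSA n => (A : Matrix (Fin n) (Fin n) ℂ) i j :=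
      fun i j => continuous_subtype_val.matrix_elem i j
    unfold coords
    split_ifs
    · exact Complex.continuous_re.comp (h i j)
    · exact Complex.continuous_im.comp (h j i)

instance MatSA.secondCountableTopology : SecondCountableTopology (MatSA n) :=
  (MatSA.coordsEquiv n).toHomeomorph.symm.isEmbedding.secondCountableTopology

instance MatSA.sigmaCompactSpace : SigmaCompactSpace (MatSA n) :=
  (MatSA.coordsEquiv n).toHomeomorph.symm.isClosedEmbedding.sigmaCompactSpace

instance MatSA.finiteDimensional : FiniteDimensional ℝ (MatSA n) :=
  (MatSA.coordsEquiv n).toLinearEquiv.finiteDimensional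

/-- Only this is used of the normalization: the power of two is nonzero and finite. -/
instance lebSA.isAddHaarMeasure : (lebSA n).IsAddHaarMeasure := by
  have : (Measure.map (MatSA.ofCoords n) volume).IsAddHaarMeasure :=
    (MatSA.coordsEquiv n).isAddHaarMeasure_map volume
  exact .smul _ (by simp) (ENNReal.pow_ne_top (by simp))

/-- The action of selfadjoint matrices on the Hilbert space `ℂⁿ`, as a real-linear map. -/
def MatSA.toCLM (n : ℕ) :
    MatSA n →ₗ[ℝ] (EuclideanSpace ℂ (Fin n) →L[ℂ] EuclideanSpace ℂ (Fin n)) where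
  toFun A := Matrix.toEuclideanCLM (n := Fin n) (𝕜 := ℂ) (A : Matrix (Fin n) (Fin n) ℂ)
  map_add' A B := by simp
  map_smul' c A := LinearMap.map_smul_of_tower
    (AlgHomClass.toAlgHom (Matrix.toEuclideanCLM (n := Fin n) (𝕜 := ℂ))).toLinearMap c
    (A : Matrix (Fin n) (Fin n) ℂ)

theorem MatSA.isClosedEmbedding_toCLM : Topology.IsClosedEmbedding (MatSA.toCLM n) :=
  LinearMap.isClosedEmbedding_of_injective (LinearMap.ker_eq_bot.2 fun _ _ h =>
    Subtype.ext ((Matrix.toEuclideanCLM (n := Fin n) (𝕜 := ℂ)).injective h))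

theorem matBall_eq (R : ℝ) : matBall N n R =
    Set.univ.pi fun _ => MatSA.toCLM n ⁻¹' Metric.closedBall 0 R := by
  ext A
  simp only [Set.mem_univ_pi, Set.mem_preimage, mem_closedBall_zero_iff]
  rfl

theorem isCompact_matBall (R : ℝ) : IsCompact (matBall N n R) := by
  rw [matBall_eq]
  exact isCompact_univ_pi fun _ =>
    MatSA.isClosedEmbedding_toCLM.isCompact_preimage (isCompact_closedBall 0 R)

theorem measurableSet_matBall (R : ℝ) : MeasurableSet (matBall N n R) :=
  (isCompact_matBall R).isClosed.measurableSet

theorem measure_matBall_pos {R : ℝ} (hR : 0 < R) :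
    0 < Measure.pi (fun _ : Fin N => lebSA n) (matBall N n R) := by
  have ho : IsOpen (Set.univ.pi fun _ : Fin N => MatSA.toCLM n ⁻¹' Metric.ball 0 R) :=
    isOpen_set_pi Set.finite_univ fun _ _ =>
      Metric.isOpen_ball.preimage MatSA.isClosedEmbedding_toCLM.continuous
  have h0 : (0 : Fin N → MatSA n) ∈ Set.univ.pi fun _ : Fin N => MatSA.toCLM n ⁻¹' Metric.ball 0 R :=
    fun _ _ => by simpa using hR
  refine (ho.measure_pos _ ⟨0, h0⟩).trans_le (measure_mono ?_)
  rw [matBall_eq]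
  exact Set.pi_mono fun _ _ => Set.preimage_mono Metric.ball_subset_closedBall

/-- The evaluation of a noncommutative polynomial at a tuple of selfadjoint matrices. -/
abbrev NCPoly.evalMat (p : NCPoly N) (A : Fin N → MatSA n) : Matrix (Fin n) (Fin n) ℂ :=
  NCPoly.evalHom (fun i => (A i : Matrix (Fin n) (Fin n) ℂ)) p

theorem NCPoly.continuous_evalMat (p : NCPoly N) :
    Continuous fun A : Fin N → MatSA n => p.evalMat A := by
  induction p using MonoidAlgebra.induction_linear with
  | zero => simpa [evalMat] using continuous_const
  | add p q hp hq =>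
    simp only [evalMat, map_add]
    exact hp.add hq
  | single w c =>
    simp only [evalMat, evalHom_single]
    refine Continuous.const_smul ?_ c
    induction w using FreeMonoid.inductionOn' with
    | one => simpa using continuous_const
    | of_mul i w ih =>
      simp only [map_mul, FreeMonoid.lift_eval_of]
      exact (continuous_subtype_val.comp (continuous_apply i)).matrix_mul ih

theorem NCPoly.isSelfAdjoint_evalMat {p : NCPoly N} (hp : IsSelfAdjoint p) (A : Fin N → MatSA n) :
    IsSelfAdjoint (p.evalMat A) :=
  isSelfAdjoint_evalHom (fun i => (A i).2) hp

theorem NCPoly.UniformlyBounded.matOpNorm_evalMat_le {R C : ℝ} {p : NCPoly N}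
    (hp : p.UniformlyBounded R C) (hC : 0 ≤ C) {A : Fin N → MatSA n} (hA : A ∈ matBall N n R) :
    matOpNorm (p.evalMat A) ≤ C := by
  have h := NCPoly.map_evalHom
    (AlgHomClass.toAlgHom (Matrix.toEuclideanCLM (n := Fin n) (𝕜 := ℂ)))
    (fun i => (A i : Matrix (Fin n) (Fin n) ℂ)) p
  have h2 := hp.norm_evalHom_le hC
    (x := fun i => Matrix.toEuclideanCLM (n := Fin n) (𝕜 := ℂ) (A i : Matrix (Fin n) (Fin n) ℂ))
    (fun i => IsSelfAdjoint.map (show IsSelfAdjoint (A i : Matrix (Fin n) (Fin n) ℂ) from (A i).2)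
      (Matrix.toEuclideanCLM (n := Fin n) (𝕜 := ℂ))) hA
  rw [matOpNorm]
  exact (congrArg norm h).trans_le h2

/-- The Gibbs weight `exp(-n² tr_n(p(A)))`. -/
def gibbsWeight (p : NCPoly N) (A : Fin N → MatSA n) : ℝ :=
  Real.exp (-(n : ℝ) ^ 2 * (normTrace (p.evalMat A)).re)

theorem partitionFn_eq (R : ℝ) (p : NCPoly N) (n : ℕ) : partitionFn R p n =
    ∫ A in matBall N n R, gibbsWeight p A ∂(Measure.pi fun _ : Fin N => lebSA n) := rfl

theorem continuous_gibbsWeight (p : NCPoly N) :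
    Continuous (gibbsWeight p : (Fin N → MatSA n) → ℝ) := by
  have h : Continuous fun A : Fin N → MatSA n => normTrace (p.evalMat A) :=
    (p.continuous_evalMat.matrix_trace).div_const _
  exact Real.continuous_exp.comp (continuous_const.mul (Complex.continuous_re.comp h))

theorem integrableOn_gibbsWeight (R : ℝ) (p : NCPoly N) :
    IntegrableOn (gibbsWeight p) (matBall N n R) (Measure.pi fun _ : Fin N => lebSA n) :=
  (continuous_gibbsWeight p).continuousOn.integrableOn_compact (isCompact_matBall R)

theorem partitionFn_pos {R : ℝ} (hR : 0 < R) (p : NCPoly N) (n : ℕ) : 0 < partitionFn R p n := by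
  rw [partitionFn_eq, setIntegral_pos_iff_support_of_nonneg_ae (f := gibbsWeight p)
    (.of_forall fun _ => (Real.exp_pos _).le) (integrableOn_gibbsWeight R p)]
  have : Function.support (gibbsWeight p : (Fin N → MatSA n) → ℝ) = Set.univ :=
    Set.eq_univ_of_forall fun _ => (Real.exp_pos _).ne'
  rw [this, Set.univ_inter]
  exact measure_matBall_pos hR

/-- The substitution `X_i ↦ X_i + p_i` in a noncommutative polynomial. -/
def NCPoly.shear (p : Fin N → NCPoly N) (q : NCPoly N) : NCPoly N :=
  NCPoly.evalHom (fun i => NCPoly.X i + p i) q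

theorem NCPoly.evalHom_shear {A : Type*} [Ring A] [Algebra ℂ A] (x : Fin N → A)
    (p : Fin N → NCPoly N) (q : NCPoly N) :
    evalHom x (shear p q) = evalHom (fun i => x i + evalHom x (p i)) q := by
  rw [shear, evalHom_evalHom]
  simp only [map_add, evalHom_X]

theorem NCPoly.isSelfAdjoint_shear {p : Fin N → NCPoly N} (hp : ∀ i, IsSelfAdjoint (p i))
    {q : NCPoly N} (hq : IsSelfAdjoint q) : IsSelfAdjoint (shear p q) :=
  isSelfAdjoint_evalHom (fun i => (isSelfAdjoint_X i).add (hp i)) hq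

theorem partitionFn_shear_le {R C : ℝ} (hC : 0 ≤ C) {p : Fin N → NCPoly N}
    (hp : ∀ i, p i ∈ NCPoly.below i) (hpC : ∀ i, (p i).UniformlyBounded R C) (q : NCPoly N)
    (n : ℕ) : partitionFn R (NCPoly.shear p q) n ≤ partitionFn (R + C) q n := by
  set μ := Measure.pi fun _ : Fin N => lebSA n
  set f : Fin N → (Fin N → MatSA n) → MatSA n := fun i A =>
    ⟨(p i).evalMat A, NCPoly.isSelfAdjoint_evalMat (hpC i).isSelfAdjoint A⟩ with hf
  set Φ : (Fin N → MatSA n) → (Fin N → MatSA n) := fun A i => A i + f i A with hΦ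
  have hmp : MeasurePreserving Φ μ μ := by
    refine measurePreserving_triangular_add (lebSA n)
      (fun i => ((p i).continuous_evalMat.subtype_mk _).measurable) fun i A B h => ?_
    exact Subtype.ext (NCPoly.evalHom_congr_of_mem_below (hp i) fun j hj =>
      congrArg Subtype.val (h j hj))
  have hweight : ∀ A, gibbsWeight (NCPoly.shear p q) A = gibbsWeight q (Φ A) := fun A => by
    rw [gibbsWeight, gibbsWeight, NCPoly.evalMat, NCPoly.evalHom_shear]
    rfl
  have hball : ∀ A ∈ matBall N n R, Φ A ∈ matBall N n (R + C) := fun A hA i => by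
    have h1 : matOpNorm (Φ A i : Matrix (Fin n) (Fin n) ℂ) ≤
        matOpNorm (A i : Matrix (Fin n) (Fin n) ℂ) + matOpNorm ((p i).evalMat A) := by
      have : (Φ A i : Matrix (Fin n) (Fin n) ℂ) =
        (A i : Matrix (Fin n) (Fin n) ℂ) + (p i).evalMat A := rfl
      rw [this, matOpNorm, map_add]
      exact norm_add_le _ _
    exact h1.trans (add_le_add (hA i) ((hpC i).matOpNorm_evalMat_le hC hA))
  -- The shear need not fill the larger ball; positivity of the weight turns the inclusion into an
  -- inequality.
  set G := (matBall N n (R + C)).indicator (gibbsWeight q) with hG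
  have hGint : Integrable G μ :=
    (integrable_indicator_iff (measurableSet_matBall _)).2 (integrableOn_gibbsWeight _ q)
  rw [partitionFn_eq, partitionFn_eq, ← integral_indicator (measurableSet_matBall R),
    ← integral_indicator (measurableSet_matBall (R + C))]
  calc ∫ A, (matBall N n R).indicator (gibbsWeight (NCPoly.shear p q)) A ∂μ
      ≤ ∫ A, G (Φ A) ∂μ := by
        refine integral_mono ?_ (hmp.integrable_comp_of_integrable hGint) fun A => ?_
        · exact (integrable_indicator_iff (measurableSet_matBall _)).2
            (integrableOn_gibbsWeight _ _)
        · by_cases hA : A ∈ matBall N n R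
          · simp only [hG, Set.indicator_of_mem hA, Set.indicator_of_mem (hball A hA), hweight,
              le_refl]
          · rw [Set.indicator_of_notMem hA]
            exact Set.indicator_nonneg (fun _ _ => (Real.exp_pos _).le) _
    _ = ∫ A, G A ∂μ := by
        rw [← integral_map hmp.measurable.aemeasurable, hmp.map_eq]
        rw [hmp.map_eq]
        exact hGint.aestronglyMeasurable

theorem freePressure_shear_le {R C : ℝ} (hR : 0 < R) (hC : 0 ≤ C) {p : Fin N → NCPoly N}
    (hp : ∀ i, p i ∈ NCPoly.below i) (hpC : ∀ i, (p i).UniformlyBounded R C) (q : NCPoly N) :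
    freePressure R (NCPoly.shear p q) ≤ freePressure (R + C) q := by
  refine limsup_le_limsup (.of_forall fun n => ?_)
  rw [EReal.coe_le_coe_iff]
  have := Real.log_le_log (partitionFn_pos hR _ n) (partitionFn_shear_le hC hp hpC q n)
  gcongr

theorem freePressure_mono {R R' : ℝ} (hR : 0 < R) (h : R ≤ R') (q : NCPoly N) :
    freePressure R q ≤ freePressure R' q := by
  -- The zero shear is bounded by any nonnegative constant, so it gives monotonicity in the radius.
  have := freePressure_shear_le (C := R' - R) hR (sub_nonneg.2 h) (p := 0)
    (fun _ => zero_mem _) (fun _ => .zero (sub_nonneg.2 h)) q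
  have e : NCPoly.shear 0 q = q := by
    simp only [NCPoly.shear, Pi.zero_apply, add_zero]
    exact NCPoly.evalHom_X_self q
  rwa [e, add_sub_cancel] at this

end Matrices

/-! ### Comparison of `η_R` and `η` for two tuples. -/

section Eta

variable {H : Type*} [NormedAddCommGroup H] [InnerProductSpace ℂ H] [CompleteSpace H]
variable {M : VonNeumannAlgebra H} (τ : FaithfulNormalTrace M) {N : ℕ}

/-- For fixed `q`, test `η_R(a)` on the sheared polynomials `q(X + p m)` and let `p m (a) → c`. -/
theorem etaR_le_etaR_add {a c : Fin N → M.toStarSubalgebra} (ha : ∀ i, IsSelfAdjoint (a i))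
    (hc : ∀ i, IsSelfAdjoint (c i))
    (hmem : ∀ i, (c i : H →L[ℂ] H) ∈
        Set.centralizer (Set.centralizer ((fun j => (a j : H →L[ℂ] H)) '' Set.Iio i)))
    {R C : ℝ} (hR : 0 < R) (haR : ∀ i, ‖a i‖ ≤ R) (hC : 0 ≤ C) (hcC : ∀ i, ‖c i‖ ≤ C) :
    etaR τ R a ≤ etaR τ (R + C) (fun i => a i + c i) := by
  refine le_iInf fun ⟨q, hq⟩ => ?_
  have hq' := (NCPoly.isSA_iff q).1 hq
  have hφ := τ.isTracialState
  choose p hp hpC hlt using fun (m : ℕ) (i : Fin N) =>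
    τ.exists_uniformlyBounded_near ha haR i (hc i) (hcC i) (hmem i)
      (Nat.one_div_pos_of_nat (α := ℝ) (n := m))
  have hpsa : ∀ m i, IsSelfAdjoint (NCPoly.evalHom a (p m i)) := fun m i =>
    NCPoly.isSelfAdjoint_evalHom ha (hpC m i).isSelfAdjoint
  have hconv : ∀ i, BoundedTendsto τ.toLinearMap (fun m => a i + NCPoly.evalHom a (p m i))
      (a i + c i) := fun i => by
    refine (BoundedTendsto.const _ (a i)).add hφ ⟨⟨C, fun m => ?_⟩, ?_⟩
    · exact (hpC m i).norm_evalHom_le hC ha haR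
    · exact squeeze_zero (fun m => hφ.sqNorm_nonneg _) (fun m => (hlt m i).le)
        tendsto_one_div_add_atTop_nhds_zero_nat
  have hlim := (BoundedTendsto.evalHom hφ hconv q).tendsto_re hφ
    (fun m => NCPoly.isSelfAdjoint_evalHom (fun i => (ha i).add (hpsa m i)) hq')
    (NCPoly.isSelfAdjoint_evalHom (fun i => (ha i).add (hc i)) hq')
  -- The pressure may be infinite, but addition in `EReal` is continuous here as the trace term is
  -- finite.
  have hlim' : Tendsto (fun m => (((τ.toLinearMap (NCPoly.evalHom
      (fun i => a i + NCPoly.evalHom a (p m i)) q)).re : ℝ) : EReal) + freePressure (R + C) q) atTop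
      (nhds ((((ncLaw τ (fun i => a i + c i) q).re : ℝ) : EReal) + freePressure (R + C) q)) :=
    (EReal.continuousAt_add (.inl (EReal.coe_ne_top _)) (.inl (EReal.coe_ne_bot _))).tendsto.comp
      ((continuous_coe_real_ereal.continuousAt.tendsto.comp hlim).prodMk_nhds tendsto_const_nhds)
  refine ge_of_tendsto' hlim' fun m => ?_
  have hsa : NCPoly.IsSA (NCPoly.shear (p m) q) := (NCPoly.isSA_iff _).2
    (NCPoly.isSelfAdjoint_shear (fun i => (hpC m i).isSelfAdjoint) hq')
  refine (iInf_le _ ⟨NCPoly.shear (p m) q, hsa⟩).trans ?_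
  have e : ncLaw τ a (NCPoly.shear (p m) q) = τ.toLinearMap (NCPoly.evalHom
      (fun i => a i + NCPoly.evalHom a (p m i)) q) := by
    rw [← NCPoly.evalHom_shear]
    rfl
  rw [e]
  exact add_le_add le_rfl (freePressure_shear_le hR hC (hp m) (hpC m) q)

theorem etaR_mono {R R' : ℝ} (hR : 0 < R) (h : R ≤ R') (a : Fin N → M.toStarSubalgebra) :
    etaR τ R a ≤ etaR τ R' a :=
  iInf_mono fun q => add_le_add le_rfl (freePressure_mono hR h q.1)

theorem eta_le_of_etaR_le {a b : Fin N → M.toStarSubalgebra} {C : ℝ} (hC : 0 ≤ C)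
    (h : ∀ R : ℝ, 0 < R → (∀ i, ‖(a i : H →L[ℂ] H)‖ ≤ R) → etaR τ R a ≤ etaR τ (R + C) b) :
    eta τ a ≤ eta τ b := by
  refine iSup_le fun ⟨R, hR⟩ => ?_
  -- The sum is a convenient upper bound for `max ‖a i‖`; enlarging the radius only increases `η_R`.
  set R' := R + ∑ i, ‖(a i : H →L[ℂ] H)‖ with hR'
  have hsum : 0 ≤ ∑ i, ‖(a i : H →L[ℂ] H)‖ := Finset.sum_nonneg fun _ _ => norm_nonneg _
  have hle : R ≤ R' := le_add_of_nonneg_right hsum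
  have hbd : ∀ i, ‖(a i : H →L[ℂ] H)‖ ≤ R' := fun i =>
    (Finset.single_le_sum (f := fun i => ‖(a i : H →L[ℂ] H)‖) (fun _ _ => norm_nonneg _)
      (Finset.mem_univ i)).trans (le_add_of_nonneg_left hR.le)
  refine (etaR_mono τ hR hle a).trans ((h R' (hR.trans_le hle) hbd).trans ?_)
  exact le_iSup (fun R : {R : ℝ // 0 < R} => etaR τ R.1 b) ⟨R' + C, by positivity⟩

end Eta

/-- If each `b_i` differs from `a_i` by an element of `{a_j : j < i}''`, then the double commutants
satisfy `{a_j : j < i}'' ⊆ {b_j : j < i}''`. -/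
theorem centralizer_centralizer_image_Iio_subset {B : Type*} [Ring B] {N : ℕ} {a b : Fin N → B}
    (h : ∀ i, b i - a i ∈ Set.centralizer (Set.centralizer (a '' Set.Iio i))) (i : Fin N) :
    Set.centralizer (Set.centralizer (a '' Set.Iio i)) ⊆
      Set.centralizer (Set.centralizer (b '' Set.Iio i)) := by
  refine Set.centralizer_subset fun y hy => ?_
  have hb : ∀ j < i, Commute (b j) y := fun j hj => hy _ ⟨j, hj, rfl⟩
  -- If `y` commutes with `a k` for `k < j`, it commutes with `b j - a j`, hence with `a j = b j -
  -- (b j - a j)`.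
  have key : ∀ j, j < i → Commute (a j) y := fun j => by
    induction j using WellFoundedLT.induction with
    | ind j ih =>
      intro hj
      have hyj : y ∈ Set.centralizer (a '' Set.Iio j) := by
        rintro _ ⟨k, hk, rfl⟩
        exact ih k hk (lt_trans hk hj)
      have := (hb j hj).sub_left (show Commute (b j - a j) y from (h j y hyj).symm)
      rwa [sub_sub_cancel] at this
  rintro _ ⟨j, hj, rfl⟩
  exact key j hj

end

theorem proposition4p8
    {H : Type*} [NormedAddCommGroup H] [InnerProductSpace ℂ H] [CompleteSpace H]
    (M : VonNeumannAlgebra H) (τ : FaithfulNormalTrace M)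
    (N : ℕ) [NeZero N] (a b : Fin N → M.toStarSubalgebra)
    (ha : ∀ i, IsSelfAdjoint (a i)) (hb : ∀ i, IsSelfAdjoint (b i))
    (h_first : b 0 = a 0)
    (h_diff : ∀ i : Fin N, i ≠ 0 →
      ((b i - a i : M.toStarSubalgebra) : H →L[ℂ] H) ∈
        Set.centralizer (Set.centralizer ((fun j => (a j : H →L[ℂ] H)) '' Set.Iio i)))
    (R₀ : ℝ)
    (hR₀ : IsGreatest
      (Set.range fun i => ‖((b i - a i : M.toStarSubalgebra) : H →L[ℂ] H)‖) R₀) :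
    (∀ R : ℝ, 0 < R → (∀ i, ‖(a i : H →L[ℂ] H)‖ ≤ R) → etaR τ R a ≤ etaR τ (R + R₀) b) ∧
    (∀ R : ℝ, 0 < R → (∀ i, ‖(b i : H →L[ℂ] H)‖ ≤ R) → etaR τ R b ≤ etaR τ (R + R₀) a) ∧
    eta τ a = eta τ b := by
  -- The equality `b 0 = a 0` is the case `i = 0` of the same condition: the difference is zero.
  have hmem : ∀ i : Fin N, ((b i - a i : M.toStarSubalgebra) : H →L[ℂ] H) ∈
      Set.centralizer (Set.centralizer ((fun j => (a j : H →L[ℂ] H)) '' Set.Iio i)) := fun i => by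
    rcases eq_or_ne i 0 with rfl | hi
    · rw [h_first, sub_self]
      exact fun y _ => (mul_zero y).trans (zero_mul y).symm
    · exact h_diff i hi
  have hnorm : ∀ i, ‖b i - a i‖ ≤ R₀ := fun i => hR₀.2 ⟨i, rfl⟩
  have hR₀0 : 0 ≤ R₀ := (norm_nonneg _).trans (hnorm 0)
  have hsub : ∀ i, IsSelfAdjoint (b i - a i) := fun i => (hb i).sub (ha i)
  have hab : ∀ R : ℝ, 0 < R → (∀ i, ‖(a i : H →L[ℂ] H)‖ ≤ R) →
      etaR τ R a ≤ etaR τ (R + R₀) b := fun R hR haR => by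
    have := etaR_le_etaR_add τ ha hsub hmem hR haR hR₀0 hnorm
    simpa only [add_sub_cancel] using this
  have hba : ∀ R : ℝ, 0 < R → (∀ i, ‖(b i : H →L[ℂ] H)‖ ≤ R) →
      etaR τ R b ≤ etaR τ (R + R₀) a := fun R hR hbR => by
    -- The inclusion of double commutants makes the hypothesis symmetric in `a` and `b`.
    have hmem' : ∀ i : Fin N, ((a i - b i : M.toStarSubalgebra) : H →L[ℂ] H) ∈
        Set.centralizer (Set.centralizer ((fun j => (b j : H →L[ℂ] H)) '' Set.Iio i)) :=
      fun i => by
        have := centralizer_centralizer_image_Iio_subset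
          (a := fun j => (a j : H →L[ℂ] H)) (b := fun j => (b j : H →L[ℂ] H)) hmem i (hmem i)
        rw [← neg_sub]
        exact Set.neg_mem_centralizer this
    have := etaR_le_etaR_add τ hb (fun i => (ha i).sub (hb i)) hmem' hR hbR hR₀0
      fun i => (norm_sub_rev _ _).trans_le (hnorm i)
    simpa only [add_sub_cancel] using this
  exact ⟨hab, hba, (eta_le_of_etaR_le τ hR₀0 hab).antisymm (eta_le_of_etaR_le τ hR₀0 hba)⟩
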